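/- **Conventions.** Let $q$ be a prime power, $\delta\ge 1$, $\ell\ge 0$, $1\le v\le r$, $h=r-v$ and $k=r\ell+v$. For an $[n,k]_q$ code $C$, the $i$-th symbol has $(r,\delta)$-locality if there is a set $R\ni i$ of at most $r+\delta-1$ coordinates such that the punctured code $C|_R$ has minimum distance at least $\delta$; $C$ has $(r,\delta)_i$-locality if all symbols of some information set have $(r,\delta)$-locality. Such a code is an *optimal LRC* if its minimum distance is $d=n-k+1-(\lceil k/r\rceil-1)(\delta-1)$. A set $E$ of erased coordinates can be *recovered* if every codeword is determined by its symbols outside $E$. An optimal LRC whose codewords are $b\times a$ arrays is an *$(s,\gamma)$-generalized sector-disk (GSD) code* if any $s$ columns together with any $\gamma$ further cells can be recovered, and $sb+\gamma>d-1$. A *$\tau$-$(n,w,1)$-packing* (respectively a *$(\tau,w,n)$-Steiner system*) is a set $X$ of $n\ge2$ points with a set of $w$-subsets of $X$ (blocks) such that each $\tau$-subset of $X$ lies in at most (respectively exactly) one block; a set system is *$t$-regular* if each point lies in exactly $t$ blocks. **The code.** Let $S=\{s_1,\dots,s_h\}\subset\mathbb F_q$ and let $X=\{x_1,\dots,x_\rho\}\subseteq\mathbb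 F_q\setminus S$ carry a $t$-regular system of $\ell+1$ distinct blocks $B_1,\dots,B_{\ell+1}$ of size $r+\delta-1$, where $\{x_1,\dots,x_h\}\subseteq B_{\ell+1}$. Put $A_j=B_j=\{\theta_{j,1},\dots,\theta_{j,r+\delta-1}\}$ for $j\le\ell$ and $A_{\ell+1}=B_{\ell+1}\setminus\{x_1,\dots,x_h\}=\{\theta_{\ell+1,1},\dots,\theta_{\ell+1,v+\delta-1}\}$. Split the $k$ information symbols into $\ell$ groups of size $r$ and a last group of size $v$, and let $f_j$ be the polynomial of degree less than $|A_j|-\delta+1$ whose values at $\theta_{j,1},\dots,\theta_{j,|A_j|-\delta+1}$ are the symbols of group $j$. With $g_j=\prod_{\theta\in A_j}(x-\theta)$ and $f_I=\prod_j g_j\cdot\sum_j f_j/g_j$, the code symbols are $c_{j,i}=f_j(\theta_{j,i})$ and the global parities $c_{\ell+2,i}=f_I(s_i)$, $1\le i\le h$. Place them in a $t\times\rho$ array: the symbols $c_{j,i}$ with $\theta_{j,i}=x_a$ stand in column $a$ (in any order), and $c_{\ell+2,i}$ stands in the last cell of column $i$. This is possible for every such set system and every such $S$. Let $\mathcal C$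 be the resulting code of length $n=t\rho$. **(A) General part.** $\mathcal C$ is a $[t\rho,k]_q$ code with $(r,\delta)_i$-locality. Suppose that the blocks form a $2$-$(\rho,r+\delta-1,1)$-packing. If $h\le\delta^2$, then $\mathcal C$ recovers from any $h+\delta-1$ erasures, and * (I) for $y\le 2$, from any $y$ columns and any other $h-2y-1$ erasures; * (II) for $\binom y2\le\delta$, from any $y$ columns and any other $h-2-\binom y2-y$ erasures. Without any restriction on $h$, * (III) for $y<\frac{(\delta+1)\delta}2-1$, it recovers from any $y$ columns and any other $\min\{\frac{(\delta+1)\delta}2-2y-1,\;h+\delta-1-2y\}$ erasures. (For a negative number of further erasures there is nothing to recover.) **(B) Instantiations.** Let now $\delta\ge2$ and $1\le v\le r-1$, let $q_1$ be a prime power and $\beta\ge2$. Consider the following set systems. * *Affine*: a $(2,q_1,q_1^\beta)$-Steiner system with $q_1=r+\delta-1$; $\rho=q_1^\beta$, $t=\frac{q_1^\beta-1}{q_1-1}$, $n=\frac{q_1^\beta(q_1^\beta-1)}{q_1-1}$, $k=\bigl(\frac{q_1^{\beta-1}(q_1^\beta-1)}{q_1-1}-1\bigr)r+v$. * *Projective*: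 a $\bigl(2,q_1+1,\frac{q_1^{\beta+1}-1}{q_1-1}\bigr)$-Steiner system with $q_1+1=r+\delta-1$; $\rho=\frac{q_1^{\beta+1}-1}{q_1-1}$, $t=\frac{q_1^\beta-1}{q_1-1}$, $n=\frac{(q_1^{\beta+1}-1)(q_1^\beta-1)}{(q_1-1)^2}$, $k=\bigl(\frac{(q_1^{\beta+1}-1)(q_1^\beta-1)}{(q_1-1)(q_1^2-1)}-1\bigr)r+v$. * *Spherical*: a $(3,q_1+1,q_1^\beta+1)$-Steiner system with $q_1+1=r+\delta-1$; $\rho=q_1^\beta+1$, $t=\binom{q_1^\beta}2/\binom{q_1}2$, $n=t\rho$, $k=\bigl(\frac{t\rho}{q_1+1}-1\bigr)r+v$. * *Cyclotomic*: a $P/e^u$-regular $2$-$(en_2,e,1)$-packing, where $e=r+\delta-1$, $u\ge1$, $n_2=p_1^{m_1}\cdots p_u^{m_u}$ with distinct primes $p_i$ and $m_i>0$, $e\mid p_i^{m_i}-1$ for all $i$, and $P=\prod_i(p_i^{m_i}-1)$; $\rho=en_2$, $t=P/e^u$, $n=n_2P/e^{u-1}$, $k=(n_2P/e^u-1)r+v$.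 In each case, for every prime power $q\ge\rho+h$ such a ($t$-regular) set system with its array code $\mathcal C$ exists over $\mathbb F_q$. Moreover, for every such system, if $h\le\delta^2$ (in the spherical case, if $h\le\lceil\delta/2\rceil\delta$), then $\mathcal C$ is an optimal $[n,k,h+\delta]_q$ LRC with $(r,\delta)_i$-locality, and, whenever the number $\gamma$ below is non-negative, * (I) if $y\le2$ and $y(t-2)>\delta$, then $\mathcal C$ is a $(y,\gamma)$-GSD code with $\gamma=h-2y-1$; * (II) if $\binom y2\le\delta$ and $yt-1-\binom y2-y>\delta$, then $\mathcal C$ is a $(y,\gamma)$-GSD code with $\gamma=h-2-\binom y2-y$; * (III) if $y<\frac{(\delta+1)\delta}2-1$ and $yt+\gamma>h+\delta-1$, then $\mathcal C$ is a $(y,\gamma)$-GSD code with $\gamma=\min\{\frac{(\delta+1)\delta}2-2y-1,\;h+\delta-1-2y\}$. **(C) Lengths.** Let $N=q_1^\beta$ in the first three cases and $N=en_2$ in the cyclotomic case. There is always a prime $q$ with $\rho+h\le q\le 8N$ (indeed $q\le4N$ in the affine and cyclotomic cases). For every constant $\Lambda$ there are constants $c,C>0$ such that the length $n$ of every such array code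 over every $\mathbb F_q$ with $q\le\Lambda N$ satisfies $c\,q^{\alpha}\le n\le C\,q^{\alpha}$, i.e. $n=\Theta(q^\alpha)$, where * affine and projective: $\alpha=2$ if $q_1,r,\delta,v$ are constants ($\beta$ varies), and $\alpha=2-1/\beta$ if $\beta$ is constant ($q_1,r,\delta,v$ vary); * spherical: $\alpha=3$ if $q_1,r,\delta,v$ are constants, and $\alpha=3-2/\beta$ if $\beta$ is constant; * cyclotomic: $\alpha=2$ if $e,u,r,\delta,v$ are constants. ($c$ and $C$ depend only on $\Lambda$ and on the parameters that are held constant.) -/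

import Mathlib

universe u

/-! ## Linear codes, locality, erasure recovery -/

section Codes

variable {K : Type*} [Field K] [DecidableEq K] {ι : Type*} [Fintype ι]

/-- The length of a linear code with coordinate set `ι`. -/
def codeLength (_C : Submodule K (ι → K)) : ℕ := Fintype.card ι

/-- The minimum Hamming distance of a (nonzero) linear code. -/
noncomputable def minDist (C : Submodule K (ι → K)) : ℕ :=
  sInf {w | ∃ c ∈ C, c ≠ 0 ∧ hammingNorm c = w}

/-- `C` is an `[n, k]` linear code. -/
def IsLinearCode (C : Submodule K (ι → K)) (n k : ℕ) : Prop :=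
  codeLength C = n ∧ Module.finrank K C = k

/-- The punctured code `C|_R`: only the code symbols indexed by `R` are kept. -/
def punctured (C : Submodule K (ι → K)) (R : Finset ι) : Submodule K (R → K) :=
  C.map (LinearMap.funLeft K K (fun i : R => (i : ι)))

/-- The `i`-th code symbol has `(r, δ)`-locality: there is a repair set `R ∋ i` with
`|R| ≤ r + δ - 1` such that all nonzero words of `C|_R` have weight at least `δ`. -/
def HasLocality (C : Submodule K (ι → K)) (r δ : ℕ) (i : ι) : Prop :=
  ∃ R : Finset ι, i ∈ R ∧ R.card ≤ r + δ - 1 ∧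
    ∀ c ∈ punctured C R, c ≠ 0 → δ ≤ hammingNorm c

/-- `(r, δ)_i`-locality: all symbols of some information set `I` have `(r, δ)`-locality.
The rank of the columns of a generator matrix indexed by `I` is the dimension of `C|_I`. -/
def HasInfoLocality (C : Submodule K (ι → K)) (r δ : ℕ) : Prop :=
  ∃ I : Finset ι, I.card = Module.finrank K C ∧
    Module.finrank K (punctured C I) = Module.finrank K C ∧
    ∀ i ∈ I, HasLocality C r δ i

/-- Optimal locally repairable code: a code with `(r, δ)_i`-locality whose minimum distance is
`n - k + 1 - (⌈k / r⌉ - 1) (δ - 1)`. -/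
def IsOptimalLRC (C : Submodule K (ι → K)) (r δ : ℕ) : Prop :=
  HasInfoLocality C r δ ∧
    (minDist C : ℤ) = (codeLength C : ℤ) - (Module.finrank K C : ℤ) + 1
      - (⌈(Module.finrank K C : ℚ) / (r : ℚ)⌉ - 1) * ((δ : ℤ) - 1)

/-- The erasure pattern `E` can be recovered: a codeword is determined by its symbols
outside `E`. -/
def Recoverable (C : Submodule K (ι → K)) (E : Set ι) : Prop :=
  ∀ c ∈ C, ∀ c' ∈ C, (∀ i, i ∉ E → c i = c' i) → c = c'

/-- A code of `b × a` arrays recovers from the erasure of any `y` columns and of any (at most)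
`γ` other cells. For negative `γ` there is no such erasure pattern. -/
def RecoversColumnsAnd {b a : ℕ} (C : Submodule K (Fin b × Fin a → K)) (y : ℕ) (γ : ℤ) : Prop :=
  ∀ Y : Finset (Fin a), Y.card = y → ∀ F : Finset (Fin b × Fin a), (F.card : ℤ) ≤ γ →
    Recoverable C ({p | p.2 ∈ Y} ∪ (F : Set (Fin b × Fin a)))

/-- A code of `b × a` arrays is (with this arrangement of its symbols) an `(s, γ)`-generalized
sector-disk code, with respect to the locality parameters `(r, δ)`. -/
def IsGSD {b a : ℕ} (C : Submodule K (Fin b × Fin a → K)) (r δ s γ : ℕ) : Prop :=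
  IsOptimalLRC C r δ ∧ RecoversColumnsAnd C s γ ∧
    (minDist C : ℤ) - 1 < (s : ℤ) * b + γ

/-- The three generalized sector-disk properties asserted for the array codes with `b` rows
and `h` global parity symbols. -/
def HasGSDItems {b a : ℕ} (C : Submodule K (Fin b × Fin a → K)) (r δ h : ℕ) : Prop :=
  (∀ y γ : ℕ, y ≤ 2 → (δ : ℤ) < y * ((b : ℤ) - 2) →
    (γ : ℤ) = (h : ℤ) - 2 * y - 1 → IsGSD C r δ y γ) ∧
  (∀ y γ : ℕ, y.choose 2 ≤ δ → (δ : ℤ) < (y : ℤ) * b - 1 - y.choose 2 - y →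
    (γ : ℤ) = (h : ℤ) - 2 - y.choose 2 - y → IsGSD C r δ y γ) ∧
  (∀ y γ : ℕ, (y : ℤ) < ((δ : ℤ) + 1) * δ / 2 - 1 → (h : ℤ) + δ - 1 < (y : ℤ) * b + γ →
    (γ : ℤ) = min (((δ : ℤ) + 1) * δ / 2 - 2 * y - 1) ((h : ℤ) + δ - 1 - 2 * y) →
    IsGSD C r δ y γ)

end Codes

/-! ## Packings and Steiner systems -/

section Designs

variable {P : Type*}

/-- `(X, 𝓑)` is a `τ-(n, b, 1)` packing. -/
def IsPacking (τ n b : ℕ) (X : Finset P) (𝓑 : Finset (Finset P)) : Prop :=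
  2 ≤ n ∧ X.card = n ∧ (∀ B ∈ 𝓑, B ⊆ X ∧ B.card = b) ∧
    ∀ T ⊆ X, T.card = τ → ∀ B ∈ 𝓑, ∀ B' ∈ 𝓑, T ⊆ B → T ⊆ B' → B = B'

/-- Every point lies in exactly `w` blocks. -/
def IsRegularSystem (w : ℕ) (X : Finset P) (𝓑 : Finset (Finset P)) : Prop :=
  ∀ x ∈ X, {B | B ∈ 𝓑 ∧ x ∈ B}.ncard = w

/-- `(X, 𝓑)` is a `(τ, b, n)`-Steiner system. -/
def IsSteiner (τ b n : ℕ) (X : Finset P) (𝓑 : Finset (Finset P)) : Prop :=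
  2 ≤ n ∧ X.card = n ∧ (∀ B ∈ 𝓑, B ⊆ X ∧ B.card = b) ∧
    ∀ T ⊆ X, T.card = τ → ∃! B, B ∈ 𝓑 ∧ T ⊆ B

end Designs

/-! ## The polynomial construction of locally repairable codes

The `k = r ℓ + v` information symbols are split into `ℓ` groups of size `r` and a last group of
size `v`; group `j` is extended to a local code on `infoLen + (δ - 1)` evaluation points. -/

/-- The size of the `j`-th group of information symbols. -/
def infoLen (ℓ r v : ℕ) (j : Fin (ℓ + 1)) : ℕ := if j = Fin.last ℓ then v else r

/-- Coordinates of the code: the local symbols `c_{j,t}` and the `h` global parities. -/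
abbrev LRCCoord (ℓ r δ v h : ℕ) : Type :=
  (Σ j : Fin (ℓ + 1), Fin (infoLen ℓ r v j + (δ - 1))) ⊕ Fin h

section Construction

open Polynomial

variable {K : Type*} [Field K] {ℓ r δ v h : ℕ}

/-- `f_j`: the polynomial of degree `< infoLen` taking the value `I_{j,t}` at the `t`-th point
of the `j`-th block, for `t < infoLen`. -/
noncomputable def localPoly (θ : (j : Fin (ℓ + 1)) → Fin (infoLen ℓ r v j + (δ - 1)) → K)
    (j : Fin (ℓ + 1)) : ((j : Fin (ℓ + 1)) → Fin (infoLen ℓ r v j) → K) →ₗ[K] K[X] :=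
  (Lagrange.interpolate Finset.univ
    (fun t : Fin (infoLen ℓ r v j) => θ j (Fin.castAdd (δ - 1) t))).comp (LinearMap.proj j)

/-- `g_j = ∏_{θ ∈ A_j} (x - θ)`. -/
noncomputable def blockPoly (θ : (j : Fin (ℓ + 1)) → Fin (infoLen ℓ r v j + (δ - 1)) → K)
    (j : Fin (ℓ + 1)) : K[X] := ∏ t, (X - C (θ j t))

/-- `f_I = Δ ∑_j f_j / g_j` with `Δ = ∏_i g_i`, i.e. `f_I = ∑_j f_j ∏_{i ≠ j} g_i`. -/
noncomputable def parityPoly (θ : (j : Fin (ℓ + 1)) → Fin (infoLen ℓ r v j + (δ - 1)) → K) :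
    ((j : Fin (ℓ + 1)) → Fin (infoLen ℓ r v j) → K) →ₗ[K] K[X] :=
  ∑ j, (LinearMap.mulRight K (∏ i ∈ Finset.univ.erase j, blockPoly θ i)).comp (localPoly θ j)

/-- The encoder: evaluations of the `f_j` on their blocks, and of `f_I` at the points `s_i`. -/
noncomputable def lrcEncoder (θ : (j : Fin (ℓ + 1)) → Fin (infoLen ℓ r v j + (δ - 1)) → K)
    (s : Fin h → K) :
    ((j : Fin (ℓ + 1)) → Fin (infoLen ℓ r v j) → K) →ₗ[K] (LRCCoord ℓ r δ v h → K) :=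
  LinearMap.pi (Sum.elim
    (fun p => (Polynomial.leval (θ p.1 p.2)).comp (localPoly θ p.1))
    (fun i => (Polynomial.leval (s i)).comp (parityPoly θ)))

/-- The locally repairable code: the set of all encodings of information vectors. -/
noncomputable def lrcCode (θ : (j : Fin (ℓ + 1)) → Fin (infoLen ℓ r v j + (δ - 1)) → K)
    (s : Fin h → K) : Submodule K (LRCCoord ℓ r δ v h → K) :=
  LinearMap.range (lrcEncoder θ s)

end Construction

/-! ## The rearranged `t × ρ` array code with `h = r - v` -/

/-- The input of the rearranged array construction over `K`: an `(r - v)`-set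
`S = {s_i}`, a `t`-regular system of `ℓ + 1` blocks `B_j` of size `r + δ - 1` on a set
`X = {x_a}` of `ρ` points outside `S`, enumerations `θ_{j,·}` of the sets `A_j`, where
`A_j = B_j` for all blocks but the last one and `A_{ℓ+1} = B_{ℓ+1} \ {x_1, …, x_{r-v}}`, and a
placement of the code symbols in a `t × ρ` array: each local symbol stands in the column of its
evaluation point, and the `i`-th global parity stands in the last cell of column `i`.
(Packing and Steiner properties of the system are separate predicates.) -/
structure RearrangedData (K : Type*) (ℓ r δ v t ρ : ℕ) where
  /-- the points `s_i` -/
  s : Fin (r - v) ↪ K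
  /-- the points `x_a` -/
  x : Fin ρ ↪ K
  s_ne_x : ∀ i a, s i ≠ x a
  /-- the blocks, pairwise distinct -/
  B : Fin (ℓ + 1) ↪ Finset K
  B_subset : ∀ j, B j ⊆ Finset.univ.map x
  B_card : ∀ j, (B j).card = r + δ - 1
  regular : ∀ a, {j | x a ∈ B j}.ncard = t
  removed_mem : ∀ a : Fin ρ, (a : ℕ) < r - v → x a ∈ B (Fin.last ℓ)
  /-- the enumeration of `A_j` -/
  θ : (j : Fin (ℓ + 1)) → Fin (infoLen ℓ r v j + (δ - 1)) ↪ K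
  range_θ : ∀ j, j ≠ Fin.last ℓ → Set.range (θ j) = (B j : Set K)
  range_θ_last : Set.range (θ (Fin.last ℓ)) =
    (B (Fin.last ℓ) : Set K) \ {z | ∃ a : Fin ρ, (a : ℕ) < r - v ∧ x a = z}
  /-- the cell (row, column) in which a code symbol is placed -/
  cell : LRCCoord ℓ r δ v (r - v) ≃ Fin t × Fin ρ
  cell_local : ∀ j i, x (cell (Sum.inl ⟨j, i⟩)).2 = θ j i
  cell_parity : ∀ i : Fin (r - v),
    ((cell (Sum.inr i)).1 : ℕ) + 1 = t ∧ ((cell (Sum.inr i)).2 : ℕ) = i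

namespace RearrangedData

variable {K : Type*} {ℓ r δ v t ρ : ℕ}

/-- The point set `X`. -/
def points (D : RearrangedData K ℓ r δ v t ρ) : Finset K := Finset.univ.map D.x

/-- The set of blocks `𝓑`. -/
def blocks (D : RearrangedData K ℓ r δ v t ρ) : Finset (Finset K) := Finset.univ.map D.B

/-- The set `S` of global parity points. -/
def parityPoints (D : RearrangedData K ℓ r δ v t ρ) : Finset K := Finset.univ.map D.s

/-- The `t × ρ` array code. -/
noncomputable def code [Field K] (D : RearrangedData K ℓ r δ v t ρ) :
    Submodule K (Fin t × Fin ρ → K) :=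
  (lrcCode (fun j => D.θ j) D.s).map (LinearMap.funLeft K K D.cell.symm)

end RearrangedData

/-! ### The degree argument for erased points -/

section CodingCore

open Polynomial Lagrange

variable {K : Type*} [Field K]

/-! Recovery is reduced to a question about overlaps of blocks. By linearity, a failure gives a
nonzero codeword supported on the erased cells. Let `E_j` be the set of erased points of `A_j`. A
nonzero `f_j` is `e_j` times the nodal polynomial of `A_j \ E_j`, with `deg e_j ≤ |E_j| - δ`, so `∑
f_j / g_j = ∑ e_j / nodal E_j = N / nodal U`, where `U` is the union of the `E_j` with at least `δ`
elements. Here `deg N ≤ |U| - δ`, and `N` vanishes at the surviving points of `S`; if there are more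
than `|U| - δ` of them, `N = 0`. At a point lying in a single `E_j` this forces `e_j` to vanish, so
every `E_j` with `f_j ≠ 0` shares at least `δ` points with the others (`exists_entangled_family`).

Let any two blocks share at most `λ` points (1 for packings and 2-designs, 2 for 3-designs). Such an
entangled family has at least `1 + δ/λ` members and at least `δ + (δ - λ) + ... ≥ δ(δ + λ)/(2λ)`
shared points (`card_biUnion_of_inter_le`, `card_of_entangled`). A shared point outside the erased
columns `Y` accounts for two cells of the remaining erasures `F`, whence `2u ≤ |F| + 2|Y|` for the
number `u` of shared points in the bound. The recovery claims all follow by comparing these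
inequalities (`exists_entangled_of_not_recoverable`). Recovery of `h + δ - 1` erasures and an
explicit word of weight at most `h + δ` give the distance.

The array exists because the `h` points removed from the last block leave room for the parities in
exactly their columns (`exists_rearrangedData`). The set systems are the lines of affine and
projective spaces, the images of a subline under `GL₂`, and graphs of affine maps over a product of
fields. Lengths are estimated by comparing `tρ` with powers of `N`, where `N ≤ q ≤ ΛN`. -/

lemma nodal_dvd_of_eval_eq_zero (s : Finset K) (f : K[X]) (h : ∀ x ∈ s, f.eval x = 0) :
    nodal s id ∣ f := by
  refine Finset.prod_dvd_of_coprime ?_ fun x hx => dvd_iff_isRoot.2 (h x hx)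
  intro x _ y _ hxy
  exact isCoprime_X_sub_C_of_isUnit_sub (sub_ne_zero.2 hxy).isUnit

variable [DecidableEq K]

/-- The dichotomy behind erasure recovery: if the local polynomials `f j` vanish on `A j \ E j`,
the global parity polynomial vanishes on `T`, and the heavily erased groups involve few enough
points, then either all `f j` are zero or some nonempty family of groups is such that every member
shares at least `δ` erased points with the others. -/
lemma exists_entangled_family {J : Type*} [Fintype J] [DecidableEq J] {δ : ℕ} (hδ : 1 ≤ δ)
    (A E : J → Finset K) (a : J → ℕ) (hA : ∀ j, (A j).card = a j + (δ - 1))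
    (hEA : ∀ j, E j ⊆ A j) (f : J → K[X]) (hf : ∀ j, (f j).degree < a j)
    (hz : ∀ j, ∀ x ∈ A j \ E j, (f j).eval x = 0)
    (T : Finset K) (hTA : ∀ j, Disjoint T (A j))
    (hT : ∀ s ∈ T, (∑ j, f j * ∏ i ∈ Finset.univ.erase j, nodal (A i) id).eval s = 0)
    (hU : ((Finset.univ.filter fun j => δ ≤ (E j).card).biUnion E).card < T.card + δ)
    (hne : ∃ j, f j ≠ 0) :
    ∃ J' : Finset J, J'.Nonempty ∧ ∀ j ∈ J', δ ≤ (E j ∩ (J'.erase j).biUnion E).card := by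
  classical
  choose e he using fun j => nodal_dvd_of_eval_eq_zero (A j \ E j) (f j) (hz j)
  have hdeg : ∀ j, f j ≠ 0 → (e j).natDegree + δ ≤ (E j).card := by
    intro j hj
    have hej : e j ≠ 0 := fun h => hj (by rw [he j, h, mul_zero])
    have h1 : (f j).natDegree < a j := (natDegree_lt_iff_degree_lt hj).2 (hf j)
    rw [he j, natDegree_mul nodal_ne_zero hej, natDegree_nodal] at h1
    have h2 := Finset.card_sdiff_add_card_eq_card (hEA j)
    have := hA j
    omega
  set J₀ := Finset.univ.filter fun j => f j ≠ 0 with hJ₀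
  set U := (Finset.univ.filter fun j => δ ≤ (E j).card).biUnion E with hUdef
  have hEU : ∀ j ∈ J₀, E j ⊆ U := by
    intro j hj
    rw [hJ₀, Finset.mem_filter] at hj
    have := hdeg j hj.2
    exact Finset.subset_biUnion_of_mem E (Finset.mem_filter.2 ⟨Finset.mem_univ _, by omega⟩)
  set N := ∑ j ∈ J₀, e j * nodal (U \ E j) id with hN
  -- After cancelling common nodal factors, the next identity says `∑ f_j / g_j = N / nodal U`.
  have hsplit : ∀ s t : Finset K, s ⊆ t → nodal (t \ s) id * nodal s id = nodal t (id : K → K) :=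
    fun s t hst => Finset.prod_sdiff hst
  have hkey : (∑ j, f j * ∏ i ∈ Finset.univ.erase j, nodal (A i) id) * nodal U id =
      (∏ i, nodal (A i) id) * N := by
    rw [hN, Finset.sum_mul, Finset.mul_sum, hJ₀, Finset.sum_filter]
    refine Finset.sum_congr rfl fun j _ => ?_
    split_ifs with hj
    · rw [← Finset.mul_prod_erase Finset.univ _ (Finset.mem_univ j), ← hsplit _ _ (hEA j),
        ← hsplit _ _ (hEU j (by simpa [hJ₀] using hj)), he j]
      ring
    · rw [not_not.1 hj]; simp
  have hN0 : N = 0 := by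
    refine eq_zero_of_degree_lt_of_eval_finset_eq_zero T ?_ fun s hs => ?_
    · refine (degree_sum_le _ _).trans_lt ?_
      rw [Finset.sup_lt_iff (WithBot.bot_lt_coe _)]
      intro j hj
      have hj' := hEU j hj
      rw [hJ₀, Finset.mem_filter] at hj
      have hd := hdeg j hj.2
      have hej : e j ≠ 0 := fun h => hj.2 (by rw [he j, h, mul_zero])
      rw [← natDegree_lt_iff_degree_lt (mul_ne_zero hej nodal_ne_zero),
        natDegree_mul hej nodal_ne_zero, natDegree_nodal]
      have := Finset.card_sdiff_add_card_eq_card hj'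
      omega
    · have := congrArg (eval s) hkey
      rw [eval_mul, hT s hs, zero_mul, eval_mul, eval_prod] at this
      refine (mul_eq_zero.1 this.symm).resolve_left (Finset.prod_ne_zero_iff.2 fun i _ => ?_)
      refine eval_nodal_not_at_node fun x hx => ?_
      rintro rfl
      exact Finset.disjoint_left.1 (hTA i) hs hx
  refine ⟨J₀, ?_, fun j hj => ?_⟩
  · obtain ⟨j, hj⟩ := hne
    exact ⟨j, by simpa [hJ₀] using hj⟩
  by_contra! hlt
  have hj' : f j ≠ 0 := by simpa [hJ₀] using hj
  have hd := hdeg j hj'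
  refine hj' ?_
  suffices h : e j = 0 by rw [he j, h, mul_zero]
  by_contra hej
  -- With fewer than `δ` shared points, `E j` has more than `deg e_j` private points; at each of
  -- them every other term of `N` vanishes.
  refine hej (eq_zero_of_degree_lt_of_eval_finset_eq_zero (E j \ (J₀.erase j).biUnion E) ?_ ?_)
  · rw [← natDegree_lt_iff_degree_lt hej]
    have := Finset.card_sdiff_add_card_inter (E j) ((J₀.erase j).biUnion E)
    omega
  · intro x hx
    rw [Finset.mem_sdiff] at hx
    have h0 := congrArg (eval x) hN0
    rw [hN, eval_finsetSum, Finset.sum_eq_single_of_mem j hj, eval_mul, eval_zero] at h0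
    · refine (mul_eq_zero.1 h0).resolve_right (eval_nodal_not_at_node fun y hy => ?_)
      rintro rfl
      exact (Finset.mem_sdiff.1 hy).2 hx.1
    · intro i hi hij
      rw [eval_mul]
      have : x ∈ U \ E i := Finset.mem_sdiff.2 ⟨hEU j hj hx.1, fun h => hx.2
        (Finset.mem_biUnion.2 ⟨i, Finset.mem_erase.2 ⟨hij, hi⟩, h⟩)⟩
      rw [show eval x (nodal (U \ E i) id) = 0 from eval_nodal_at_node (v := id) this, mul_zero]

end CodingCore

/-! ### Counting in families of sets with small overlaps -/

section Entangled

variable {J P : Type*} [DecidableEq J] [DecidableEq P]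

/-- Peeling off one member and deleting its points from the rest lowers `δ` by at most `lam` and
keeps the overlap bound, so the union has at least `δ + (δ - lam) + ...` points. The condition `δ ≤
lam * J'.card` ensures that the sets do not run out before the terms reach zero. -/
lemma card_biUnion_of_inter_le {lam : ℕ} (J' : Finset J) : ∀ (δ : ℕ) (E : J → Finset P),
    (∀ j ∈ J', δ ≤ (E j).card) →
    (∀ i ∈ J', ∀ j ∈ J', i ≠ j → (E i ∩ E j).card ≤ lam) → δ ≤ lam * J'.card →
    δ * (δ + lam) ≤ 2 * lam * (J'.biUnion E).card := by
  induction J' using Finset.induction_on with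
  | empty =>
    intro δ E _ _ h
    have : δ = 0 := by simpa using h
    simp [this]
  | insert j J' hj ih =>
    intro δ E h1 h2 h3
    rw [Finset.card_insert_of_notMem hj] at h3
    have hu : ((insert j J').biUnion E).card =
        (E j).card + (J'.biUnion fun i => E i \ E j).card := by
      rw [Finset.biUnion_insert, ← Finset.union_sdiff_self_eq_union, Finset.card_union_of_disjoint
        Finset.disjoint_sdiff]
      congr 2
      ext x
      simp only [Finset.mem_sdiff, Finset.mem_biUnion]
      tauto
    have hd := h1 j (Finset.mem_insert_self _ _)
    have hih := ih (δ - lam) (fun i => E i \ E j) (fun i hi => ?_) (fun i hi k hk hik => ?_) ?_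
    · rw [hu]
      -- When `δ ≤ lam` the subtraction truncates to zero, but the single set `E j` already
      -- suffices.
      rcases le_total δ lam with h | h
      · nlinarith [Nat.zero_le (2 * lam * (J'.biUnion fun i => E i \ E j).card)]
      · obtain ⟨d, rfl⟩ := Nat.exists_eq_add_of_le h
        rw [Nat.add_sub_cancel_left] at hih
        nlinarith
    · have := h1 i (Finset.mem_insert_of_mem hi)
      have h4 := h2 i (Finset.mem_insert_of_mem hi) j (Finset.mem_insert_self _ _)
        (fun h => hj (h ▸ hi))
      have := Finset.card_sdiff_add_card_inter (E i) (E j)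
      omega
    · exact (Finset.card_le_card (Finset.inter_subset_inter Finset.sdiff_subset
        Finset.sdiff_subset)).trans
        (h2 i (Finset.mem_insert_of_mem hi) k (Finset.mem_insert_of_mem hk) hik)
    · rw [mul_add, mul_one] at h3
      omega

/-- Size of a family of sets with pairwise intersections of size at most `lam`, each of which shares
at least `δ` points with the others. -/
lemma card_of_entangled {lam δ : ℕ} (J' : Finset J) (hJ' : J'.Nonempty) (E : J → Finset P)
    (h2 : ∀ i ∈ J', ∀ j ∈ J', i ≠ j → (E i ∩ E j).card ≤ lam)
    (h1 : ∀ j ∈ J', δ ≤ (E j ∩ (J'.erase j).biUnion E).card) :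
    δ + lam ≤ lam * J'.card ∧ ∃ V : Finset P, δ * (δ + lam) ≤ 2 * lam * V.card ∧
      ∀ Y : Finset P, 2 * V.card ≤ (∑ j ∈ J', (E j \ Y).card) + 2 * Y.card := by
  have h3 : δ + lam ≤ lam * J'.card := by
    obtain ⟨j, hj⟩ := hJ'
    have h4 : (E j ∩ (J'.erase j).biUnion E).card ≤ (J'.erase j).card * lam := by
      rw [Finset.inter_biUnion]
      refine Finset.card_biUnion_le_card_mul _ _ _ fun i hi => ?_
      rw [Finset.mem_erase] at hi
      exact h2 j hj i hi.2 (Ne.symm hi.1)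
    have h5 := h1 j hj
    have h6 := Finset.card_erase_add_one hj
    rw [← h6]
    nlinarith
  -- `V` is the set of points lying in at least two members of the family.
  refine ⟨h3, J'.biUnion fun j => E j ∩ (J'.erase j).biUnion E, ?_, fun Y => ?_⟩
  · refine card_biUnion_of_inter_le J' δ _ h1 (fun i hi j hj hij => ?_) (by omega)
    exact (Finset.card_le_card (Finset.inter_subset_inter Finset.inter_subset_left
        Finset.inter_subset_left)).trans (h2 i hi j hj hij)
  · set V := J'.biUnion fun j => E j ∩ (J'.erase j).biUnion E with hV
    have h7 : V.card ≤ (V \ Y).card + Y.card := by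
      have := Finset.card_sdiff_add_card_inter V Y
      have := Finset.card_le_card (Finset.inter_subset_right (s₁ := V) (s₂ := Y))
      omega
    -- Double counting: a point of `V` outside `Y` is counted by at least two of the sets.
    have h8 : (V \ Y).card * 2 ≤ ∑ j ∈ J', (E j \ Y).card := by
      have : ∀ x ∈ V \ Y, 2 ≤ (J'.filter fun j => x ∈ E j \ Y).card := by
        intro x hx
        rw [Finset.mem_sdiff, hV, Finset.mem_biUnion] at hx
        obtain ⟨⟨j, hj, hxj⟩, hxY⟩ := hx
        rw [Finset.mem_inter, Finset.mem_biUnion] at hxj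
        obtain ⟨hxj, i, hi, hxi⟩ := hxj
        rw [Finset.mem_erase] at hi
        exact Finset.one_lt_card.2 ⟨i, by simp [hi.2, hxi, hxY], j, by simp [hj, hxj, hxY], hi.1⟩
      calc (V \ Y).card * 2 ≤ ∑ x ∈ V \ Y, (J'.filter fun j => x ∈ E j \ Y).card := by
            rw [← smul_eq_mul]; exact Finset.card_nsmul_le_sum _ _ _ this
        _ = ∑ j ∈ J', ((V \ Y).filter fun x => x ∈ E j \ Y).card :=
            Finset.sum_card_bipartiteAbove_eq_sum_card_bipartiteBelow _
        _ ≤ _ := Finset.sum_le_sum fun j _ => Finset.card_le_card fun x hx =>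
            (Finset.mem_filter.1 hx).2
    omega

end Entangled

/-! ### Local polynomials and code symbols -/

section Encoder

open Polynomial

variable {K : Type*} [Field K] {ℓ r δ v h : ℕ}

lemma sum_infoLen : ∑ j, infoLen ℓ r v j = ℓ * r + v := by
  rw [Fin.sum_univ_castSucc]
  simp [infoLen, (Fin.castSucc_lt_last _).ne]

lemma infoLen_le (hv : v ≤ r) (j : Fin (ℓ + 1)) : infoLen ℓ r v j ≤ r := by
  unfold infoLen; split_ifs <;> omega

variable (θ : (j : Fin (ℓ + 1)) → Fin (infoLen ℓ r v j + (δ - 1)) ↪ K)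

omit [Field K] in
lemma injOn_castAdd (j : Fin (ℓ + 1)) :
    Set.InjOn (fun t : Fin (infoLen ℓ r v j) => θ j (Fin.castAdd (δ - 1) t))
      (Finset.univ : Finset (Fin (infoLen ℓ r v j))) :=
  fun _ _ _ _ hab => Fin.castAdd_injective _ _ ((θ j).injective hab)

lemma degree_localPoly_lt (j : Fin (ℓ + 1)) (m : (j : Fin (ℓ + 1)) → Fin (infoLen ℓ r v j) → K) :
    (localPoly (fun j => θ j) j m).degree < infoLen ℓ r v j := by
  refine (Lagrange.degree_interpolate_lt (m j) (injOn_castAdd θ j)).trans_eq ?_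
  rw [Finset.card_univ, Fintype.card_fin]

lemma eval_localPoly_node (j : Fin (ℓ + 1)) (t : Fin (infoLen ℓ r v j))
    (m : (j : Fin (ℓ + 1)) → Fin (infoLen ℓ r v j) → K) :
    (localPoly (fun j => θ j) j m).eval (θ j (Fin.castAdd (δ - 1) t)) = m j t :=
  Lagrange.eval_interpolate_at_node (m j) (injOn_castAdd θ j) (Finset.mem_univ t)

lemma exists_localPoly_eq (p : Fin (ℓ + 1) → K[X]) (hp : ∀ j, (p j).degree < infoLen ℓ r v j) :
    ∃ m, ∀ j, localPoly (fun j => θ j) j m = p j :=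
  ⟨fun j t => (p j).eval (θ j (Fin.castAdd (δ - 1) t)), fun j =>
    (Lagrange.eq_interpolate (injOn_castAdd θ j) (by simpa using hp j)).symm⟩

lemma eq_zero_of_localPoly_eq_zero {m : (j : Fin (ℓ + 1)) → Fin (infoLen ℓ r v j) → K}
    (h : ∀ j, localPoly (fun j => θ j) j m = 0) : m = 0 := by
  funext j t
  rw [← eval_localPoly_node θ j t m, h j, eval_zero]; rfl

lemma lrcEncoder_inl (s : Fin h → K) (m : (j : Fin (ℓ + 1)) → Fin (infoLen ℓ r v j) → K) (j i) :
    lrcEncoder (fun j => θ j) s m (Sum.inl ⟨j, i⟩) =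
      (localPoly (fun j => θ j) j m).eval (θ j i) := by
  simp [lrcEncoder, Polynomial.leval]

/-- The nodal form of the parities is the one required by `exists_entangled_family`. -/
lemma lrcEncoder_inr (s : Fin h → K) (m : (j : Fin (ℓ + 1)) → Fin (infoLen ℓ r v j) → K) (i) :
    lrcEncoder (fun j => θ j) s m (Sum.inr i) =
      (∑ j, localPoly (fun j => θ j) j m * ∏ i ∈ Finset.univ.erase j,
        Lagrange.nodal (Finset.univ.map (θ i)) id).eval (s i) := by
  simp [lrcEncoder, Polynomial.leval, parityPoly, blockPoly, Lagrange.nodal]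

lemma lrcEncoder_injective (s : Fin h → K) : Function.Injective (lrcEncoder (fun j => θ j) s) := by
  rw [← LinearMap.ker_eq_bot, LinearMap.ker_eq_bot']
  intro m hm
  funext j t
  rw [← eval_localPoly_node θ j t m, ← lrcEncoder_inl θ s, hm]; rfl

end Encoder

/-! ### From unrecoverable erasures to entangled blocks -/

namespace RearrangedData

open Polynomial

variable {K : Type*} [Field K] {ℓ r δ v t ρ : ℕ} (D : RearrangedData K ℓ r δ v t ρ)

lemma mem_code {c : Fin t × Fin ρ → K} : c ∈ D.code ↔
    ∃ m, c = fun p => lrcEncoder (fun j => D.θ j) D.s m (D.cell.symm p) := by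
  simp only [code, lrcCode, Submodule.mem_map, LinearMap.mem_range, exists_exists_eq_and]
  exact exists_congr fun m => eq_comm

lemma finrank_code : Module.finrank K D.code = ℓ * r + v := by
  rw [code, lrcCode, ← LinearMap.range_comp, LinearMap.finrank_range_of_inj]
  · rw [Module.finrank_pi_fintype, ← sum_infoLen (ℓ := ℓ) (r := r)]
    simp
  · exact (LinearMap.funLeft_injective_of_surjective K K _ D.cell.symm.surjective).comp
      (lrcEncoder_injective D.θ D.s)

omit [Field K] in
lemma range_θ_subset (j : Fin (ℓ + 1)) : Finset.univ.map (D.θ j) ⊆ D.B j := by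
  intro z hz
  have hz' : z ∈ Set.range (D.θ j) := by simpa using hz
  by_cases hj : j = Fin.last ℓ
  · subst hj
    rw [D.range_θ_last] at hz'
    exact hz'.1
  · rw [D.range_θ j hj] at hz'
    exact hz'

-- Counting both sides of `cell` expresses the length through `k`, the local redundancy and `h`, as
-- the optimality formula needs.
omit [Field K] in
lemma card_cells (D : RearrangedData K ℓ r δ v t ρ) :
    ℓ * r + v + (ℓ + 1) * (δ - 1) + (r - v) = t * ρ := by
  have := Fintype.card_congr D.cell
  rw [Fintype.card_sum, Fintype.card_sigma] at this
  simpa [Finset.sum_add_distrib, sum_infoLen] using this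

omit [Field K] in
lemma card_le [Fintype K] (D : RearrangedData K ℓ r δ v t ρ) :
    ρ + (r - v) ≤ Fintype.card K := by
  have : Function.Injective (Sum.elim D.x D.s) :=
    D.x.injective.sumElim D.s.injective fun a i => (D.s_ne_x i a).symm
  simpa using Fintype.card_le_of_injective _ this

/-- Here `m` is the number of entangled blocks and `u` the number of shared points. An erased column
adds at most one point to `U` and destroys at most one parity, and any other erased cell does only
one of the two; hence the weight 2 of `Y.card` in `hF`. -/
lemma exists_entangled_of_not_recoverable [DecidableEq K] {lam : ℕ} (hδ : 1 ≤ δ)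
    (hB : ∀ i j, i ≠ j → (D.B i ∩ D.B j).card ≤ lam) (Y : Finset (Fin ρ))
    (F : Finset (Fin t × Fin ρ)) (hF : 2 * Y.card + F.card < (r - v) + δ)
    (hrec : ¬ Recoverable D.code ({p | p.2 ∈ Y} ∪ (F : Set (Fin t × Fin ρ)))) :
    ∃ m u : ℕ, δ + lam ≤ lam * m ∧ δ * (δ + lam) ≤ 2 * lam * u ∧
      2 * u ≤ F.card + 2 * Y.card ∧ (Y = ∅ → m * δ ≤ F.card) := by
  classical
  have hrec' : ∃ m, m ≠ 0 ∧ ∀ q, (D.cell q).2 ∉ Y → D.cell q ∉ F →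
      lrcEncoder (fun j => D.θ j) D.s m q = 0 := by
    simp only [Recoverable] at hrec
    push Not at hrec
    -- The difference of two words agreeing off the erasures is the encoding of a nonzero message.
    obtain ⟨c, hc, c', hc', heq, hne⟩ := hrec
    obtain ⟨m, hm⟩ := D.mem_code.1 (Submodule.sub_mem _ hc hc')
    refine ⟨m, ?_, fun q hqY hqF => ?_⟩
    · rintro rfl
      refine hne (sub_eq_zero.1 ?_)
      rw [hm, map_zero]; rfl
    · have h1 := congrFun hm (D.cell q)
      rw [Equiv.symm_apply_apply, Pi.sub_apply, heq _ (by simp [hqY, hqF]), sub_self] at h1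
      exact h1.symm
  obtain ⟨m, hm0, hm⟩ := hrec'
  set G : (j : Fin (ℓ + 1)) → Finset (Fin (infoLen ℓ r v j + (δ - 1))) := fun j =>
    Finset.univ.filter fun i => D.cell (Sum.inl ⟨j, i⟩) ∈ F with hG
  set E : Fin (ℓ + 1) → Finset K := fun j =>
    (Finset.univ.filter fun i => (D.cell (Sum.inl ⟨j, i⟩)).2 ∈ Y ∨
      D.cell (Sum.inl ⟨j, i⟩) ∈ F).map (D.θ j) with hE
  set A : Fin (ℓ + 1) → Finset K := fun j => Finset.univ.map (D.θ j) with hA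
  set Q := Finset.univ.filter fun i : Fin (r - v) => (D.cell (Sum.inr i)).2 ∈ Y ∨
      D.cell (Sum.inr i) ∈ F with hQ
  set T := Qᶜ.map D.s with hT
  have hEA : ∀ j, E j ⊆ A j := fun j => Finset.map_subset_map.2 (Finset.filter_subset _ _)
  have hGF : (Finset.univ.sigma G).card + (F.filter fun p => (D.cell.symm p).isRight).card
      ≤ F.card := by
    rw [← Finset.card_filter_add_card_filter_not (s := F) (fun p => (D.cell.symm p).isRight),
      add_comm]
    refine Nat.add_le_add_left (Finset.card_le_card_of_injOn (fun q => D.cell (Sum.inl q)) ?_ ?_) _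
    · rintro ⟨j, i⟩ hq
      have : D.cell (Sum.inl ⟨j, i⟩) ∈ F := by simpa [hG] using hq
      simp [this]
    · exact fun a _ b _ hab => Sum.inl_injective (D.cell.injective hab)
  have hQc : Q.card ≤ Y.card + (F.filter fun p => (D.cell.symm p).isRight).card := by
    have : Q ⊆ (Finset.univ.filter fun i : Fin (r - v) => (D.cell (Sum.inr i)).2 ∈ Y) ∪
        (Finset.univ.filter fun i : Fin (r - v) => D.cell (Sum.inr i) ∈ F) := by
      intro i; simp [hQ]
    refine (Finset.card_le_card this).trans ((Finset.card_union_le _ _).trans ?_)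
    -- Distinct parities stand in distinct columns, so at most `Y.card` of them are lost with the
    -- columns.
    refine add_le_add (Finset.card_le_card_of_injOn (fun i => (D.cell (Sum.inr i)).2) ?_ ?_)
      (Finset.card_le_card_of_injOn (fun i => D.cell (Sum.inr i)) ?_ ?_)
    · intro i hi; simpa using hi
    · intro a _ b _ hab
      have := (D.cell_parity a).2
      have h2 := (D.cell_parity b).2
      have hab' := congrArg Fin.val hab
      exact Fin.ext (by simp only at hab'; omega)
    · intro i hi; simpa using hi
    · exact fun a _ b _ hab => Sum.inr_injective (D.cell.injective hab)
  have hTc : T.card + Q.card = r - v := by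
    rw [hT, Finset.card_map, Finset.card_compl_add_card, Fintype.card_fin]
  have hEY : ∀ J' : Finset (Fin (ℓ + 1)), ∑ j ∈ J', (E j \ Y.map D.x).card ≤
      (Finset.univ.sigma G).card := by
    intro J'
    rw [Finset.card_sigma]
    refine (Finset.sum_le_sum fun j _ => ?_).trans
      (Finset.sum_le_sum_of_subset (Finset.subset_univ J'))
    rw [← Finset.card_map (D.θ j)]
    refine Finset.card_le_card fun z hz => ?_
    simp only [hE, Finset.mem_sdiff, Finset.mem_map, Finset.mem_filter, Finset.mem_univ,
      true_and, not_exists, not_and] at hz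
    obtain ⟨⟨i, hi, rfl⟩, hY⟩ := hz
    refine Finset.mem_map_of_mem _ (Finset.mem_filter.2 ⟨Finset.mem_univ _, hi.resolve_left ?_⟩)
    exact fun h => hY _ h (D.cell_local j i)
  have hU : ((Finset.univ.filter fun j => δ ≤ (E j).card).biUnion E).card ≤
      Y.card + (Finset.univ.sigma G).card := by
    refine (Finset.card_le_card
      (t := Y.map D.x ∪ Finset.univ.biUnion fun j => E j \ Y.map D.x) ?_).trans ?_
    · intro z hz
      simp only [Finset.mem_biUnion, Finset.mem_filter, Finset.mem_univ, true_and] at hz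
      obtain ⟨j, _, hz⟩ := hz
      by_cases hzY : z ∈ Y.map D.x
      · exact Finset.mem_union_left _ hzY
      · exact Finset.mem_union_right _ (Finset.mem_biUnion.2
          ⟨j, Finset.mem_univ _, Finset.mem_sdiff.2 ⟨hz, hzY⟩⟩)
    · refine (Finset.card_union_le _ _).trans ?_
      rw [Finset.card_map]
      exact Nat.add_le_add_left (Finset.card_biUnion_le.trans (hEY _)) _
  obtain ⟨J', hJ', hent⟩ := exists_entangled_family hδ A E (infoLen ℓ r v) (fun j => by simp [hA])
    hEA (fun j => localPoly (fun j => D.θ j) j m) (fun j => degree_localPoly_lt D.θ j m)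
    (fun j z hz => by
      rw [Finset.mem_sdiff] at hz
      obtain ⟨i, _, rfl⟩ := Finset.mem_map.1 hz.1
      have hi : ¬ ((D.cell (Sum.inl ⟨j, i⟩)).2 ∈ Y ∨ D.cell (Sum.inl ⟨j, i⟩) ∈ F) := fun h =>
        hz.2 (Finset.mem_map_of_mem _ (Finset.mem_filter.2 ⟨Finset.mem_univ _, h⟩))
      rw [not_or] at hi
      rw [← lrcEncoder_inl D.θ D.s]
      exact hm _ hi.1 hi.2)
    T (fun j => by
      rw [Finset.disjoint_left]
      intro z hz hz'
      obtain ⟨i, _, rfl⟩ := Finset.mem_map.1 hz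
      obtain ⟨a, _, ha⟩ := Finset.mem_map.1 (D.B_subset _ (D.range_θ_subset j hz'))
      exact D.s_ne_x _ _ ha.symm)
    (fun z hz => by
      obtain ⟨i, hi, rfl⟩ := Finset.mem_map.1 hz
      have hi' : ¬ ((D.cell (Sum.inr i)).2 ∈ Y ∨ D.cell (Sum.inr i) ∈ F) := by
        simpa [hQ] using hi
      rw [not_or] at hi'
      exact (lrcEncoder_inr D.θ D.s m i).symm.trans (hm _ hi'.1 hi'.2))
    -- `|U| + |Q| ≤ 2|Y| + |F| < h + δ`, while `|T| = h - |Q|`.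
    (by omega)
    (by
      by_contra! h
      exact hm0 (eq_zero_of_localPoly_eq_zero D.θ h))
  obtain ⟨h1, V, h2, h3⟩ := card_of_entangled J' hJ' E (fun i _ j _ hij =>
    (Finset.card_le_card (Finset.inter_subset_inter ((hEA i).trans (D.range_θ_subset i))
      ((hEA j).trans (D.range_θ_subset j)))).trans (hB i j hij)) hent
  refine ⟨J'.card, V.card, h1, h2, ?_, fun hY => ?_⟩
  · have := h3 (Y.map D.x)
    have := hEY J'
    rw [Finset.card_map] at *
    omega
  · have h4 := hEY J'
    rw [hY, Finset.map_empty] at h4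
    have h5 : J'.card * δ ≤ ∑ j ∈ J', (E j \ ∅).card := by
      rw [← smul_eq_mul]
      refine Finset.card_nsmul_le_sum _ _ _ fun j hj => ?_
      rw [Finset.sdiff_empty]
      exact (hent j hj).trans (Finset.card_le_card Finset.inter_subset_left)
    omega

end RearrangedData

/-! ### Locality, minimum distance and recovery ranges -/

namespace RearrangedData

open Polynomial

variable {K : Type*} [Field K] {ℓ r δ v t ρ : ℕ} (D : RearrangedData K ℓ r δ v t ρ)

lemma isLinearCode_code : IsLinearCode D.code (t * ρ) (ℓ * r + v) :=
  ⟨by simp [codeLength], D.finrank_code⟩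

variable [DecidableEq K]

/-- The group is its own repair set: a nonzero `f_j` has fewer than `infoLen` roots among `infoLen +
δ - 1` points, so at least `δ` of its values are nonzero. -/
lemma hasLocality_local (hδ : 1 ≤ δ) (hv : v ≤ r) (j : Fin (ℓ + 1))
    (i : Fin (infoLen ℓ r v j + (δ - 1))) :
    HasLocality D.code r δ (D.cell (Sum.inl ⟨j, i⟩)) := by
  classical
  have hinj : Function.Injective fun i => D.cell (Sum.inl ⟨j, i⟩) := fun a b hab => by
    simpa using D.cell.injective hab
  refine ⟨Finset.univ.map ⟨_, hinj⟩, Finset.mem_map_of_mem ⟨_, hinj⟩ (Finset.mem_univ i), ?_, ?_⟩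
  · have := infoLen_le (ℓ := ℓ) hv j
    rw [Finset.card_map, Finset.card_univ, Fintype.card_fin]
    omega
  · rintro _ ⟨c, hc, rfl⟩ hne
    obtain ⟨m, rfl⟩ := D.mem_code.1 hc
    have hval : ∀ i, lrcEncoder (fun j => D.θ j) D.s m
        (D.cell.symm (D.cell (Sum.inl ⟨j, i⟩))) =
        (localPoly (fun j => D.θ j) j m).eval (D.θ j i) := fun i => by
      rw [Equiv.symm_apply_apply, lrcEncoder_inl]
    have hf : localPoly (fun j => D.θ j) j m ≠ 0 := by
      intro h0
      refine hne (funext fun ⟨p, hp⟩ => ?_)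
      obtain ⟨i, _, rfl⟩ := Finset.mem_map.1 hp
      simp only [LinearMap.funLeft_apply, Function.Embedding.coeFn_mk, Pi.zero_apply]
      rw [hval, h0, eval_zero]
    have hzeros : ((Finset.univ.filter fun i =>
        (localPoly (fun j => D.θ j) j m).eval (D.θ j i) = 0).map (D.θ j)).card <
        infoLen ℓ r v j := by
      by_contra! hle
      refine hf (eq_zero_of_degree_lt_of_eval_finset_eq_zero _
        ((degree_localPoly_lt D.θ j m).trans_le (Nat.cast_le.2 hle)) fun z hz => ?_)
      obtain ⟨i, hi, rfl⟩ := Finset.mem_map.1 hz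
      exact (Finset.mem_filter.1 hi).2
    have hsum := Finset.card_filter_add_card_filter_not (s := Finset.univ)
      fun i => (localPoly (fun j => D.θ j) j m).eval (D.θ j i) = 0
    rw [Finset.card_map] at hzeros
    rw [Finset.card_univ, Fintype.card_fin] at hsum
    refine le_trans (by omega : δ ≤ (Finset.univ.filter fun i =>
      ¬ (localPoly (fun j => D.θ j) j m).eval (D.θ j i) = 0).card) ?_
    refine Finset.card_le_card_of_injOn
      (fun i => ⟨D.cell (Sum.inl ⟨j, i⟩), Finset.mem_map_of_mem ⟨_, hinj⟩ (Finset.mem_univ i)⟩)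
      (fun i hi => ?_) fun a _ b _ hab => hinj (congrArg Subtype.val hab)
    refine Finset.mem_filter.2 ⟨Finset.mem_univ _, fun h0 => (Finset.mem_filter.1 hi).2 ?_⟩
    rw [← hval]
    exact h0

lemma hasInfoLocality_code (hδ : 1 ≤ δ) (hv : v ≤ r) : HasInfoLocality D.code r δ := by
  classical
  have hinj : Function.Injective fun q : Σ j : Fin (ℓ + 1), Fin (infoLen ℓ r v j) =>
      D.cell (Sum.inl ⟨q.1, Fin.castAdd (δ - 1) q.2⟩) := by
    rintro ⟨j, a⟩ ⟨j', a'⟩ hab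
    have := Sum.inl_injective (D.cell.injective hab)
    simp only [Sigma.mk.injEq] at this
    obtain ⟨rfl, h⟩ := this
    rw [Fin.castAdd_injective _ _ (eq_of_heq h)]
  refine ⟨Finset.univ.map ⟨_, hinj⟩, ?_, ?_, ?_⟩
  · rw [Finset.card_map, Finset.card_univ, Fintype.card_sigma, D.finrank_code, ← sum_infoLen]
    simp
  · rw [punctured, ← LinearMap.range_domRestrict, LinearMap.finrank_range_of_inj]
    rw [← LinearMap.ker_eq_bot, LinearMap.ker_eq_bot']
    rintro ⟨c, hc⟩ h0
    obtain ⟨m, rfl⟩ := D.mem_code.1 hc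
    have hm : m = 0 := by
      funext j a
      have := congrFun h0 ⟨_, Finset.mem_map_of_mem ⟨_, hinj⟩ (Finset.mem_univ ⟨j, a⟩)⟩
      simp only [LinearMap.domRestrict_apply, LinearMap.funLeft_apply,
        Function.Embedding.coeFn_mk] at this
      rw [Equiv.symm_apply_apply, lrcEncoder_inl, eval_localPoly_node] at this
      exact this
    subst hm
    ext p
    simp
  · intro p hp
    obtain ⟨⟨j, a⟩, _, rfl⟩ := Finset.mem_map.1 hp
    exact D.hasLocality_local hδ hv j _

/-- Let only the last `f_j` be nonzero, of degree `v - 1` with all its roots in the last group: `δ`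
local symbols and at most `h` parities survive. -/
lemma exists_light_codeword (hδ : 1 ≤ δ) (hv : 1 ≤ v) :
    ∃ c ∈ D.code, c ≠ 0 ∧ hammingNorm c ≤ (r - v) + δ := by
  classical
  have hL : infoLen ℓ r v (Fin.last ℓ) = v := by simp [infoLen]
  set Z : Finset K := (Finset.univ.filter fun i : Fin (infoLen ℓ r v (Fin.last ℓ) + (δ - 1)) =>
    (i : ℕ) < v - 1).map (D.θ _) with hZ
  have hZc : Z.card = v - 1 := by
    rw [hZ, Finset.card_map, Fin.card_filter_val_lt]
    omega
  obtain ⟨m, hm⟩ := exists_localPoly_eq D.θ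
    (fun j => if j = Fin.last ℓ then Lagrange.nodal Z id else 0) (by
      intro j
      split_ifs with hj
      · subst hj
        rw [Lagrange.degree_nodal, hZc, hL]
        exact Nat.cast_lt.2 (by omega)
      · rw [degree_zero]; exact WithBot.bot_lt_coe _)
  refine ⟨_, D.mem_code.2 ⟨m, rfl⟩, ?_, ?_⟩
  · intro h0
    have : m = 0 := lrcEncoder_injective D.θ D.s (by
      rw [map_zero]
      funext q
      simpa using congrFun h0 (D.cell q))
    have h1 := hm (Fin.last ℓ)
    rw [this, map_zero, if_pos rfl] at h1
    exact Lagrange.nodal_ne_zero h1.symm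
  · let g : Fin (r - v) ⊕ Fin δ → Fin t × Fin ρ := Sum.elim (fun i => D.cell (Sum.inr i))
      fun i => D.cell (Sum.inl ⟨Fin.last ℓ, ⟨v - 1 + i, by omega⟩⟩)
    refine (Finset.card_le_card (t := Finset.univ.image g) fun p hp => ?_).trans
      (Finset.card_image_le.trans (by simp))
    obtain ⟨q, rfl⟩ := D.cell.surjective p
    replace hp : lrcEncoder (fun j => D.θ j) D.s m q ≠ 0 := by
      simpa using (Finset.mem_filter.1 hp).2
    rcases q with ⟨j, i⟩ | i
    · rw [lrcEncoder_inl, hm] at hp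
      by_cases hj : j = Fin.last ℓ
      · subst hj
        rw [if_pos rfl] at hp
        have hi : ¬ (i : ℕ) < v - 1 := fun hi => hp (Lagrange.eval_nodal_at_node (v := id)
          (Finset.mem_map_of_mem _ (Finset.mem_filter.2 ⟨Finset.mem_univ i, hi⟩)))
        refine Finset.mem_image.2 ⟨Sum.inr ⟨i - (v - 1), by omega⟩, Finset.mem_univ _, ?_⟩
        simp only [g, Sum.elim_inr]
        congr 3
        exact Fin.ext (by simp only; omega)
      · rw [if_neg hj, eval_zero] at hp
        exact absurd rfl hp
    · exact Finset.mem_image.2 ⟨Sum.inl i, Finset.mem_univ _, rfl⟩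

/-- The support of a nonzero codeword is never recoverable, since the word and `0` agree outside it.
-/
lemma minDist_code (hδ : 1 ≤ δ) (hv : 1 ≤ v)
    (hrec : ∀ E : Finset (Fin t × Fin ρ), E.card ≤ (r - v) + δ - 1 →
      Recoverable D.code (E : Set (Fin t × Fin ρ))) : minDist D.code = (r - v) + δ := by
  obtain ⟨c, hc, hc0, hw⟩ := D.exists_light_codeword hδ hv
  have hmem : hammingNorm c ∈ {w | ∃ c ∈ D.code, c ≠ 0 ∧ hammingNorm c = w} := ⟨c, hc, hc0, rfl⟩
  refine le_antisymm ((Nat.sInf_le hmem).trans hw) (le_csInf ⟨_, hmem⟩ ?_)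
  rintro _ ⟨c', hc', hne, rfl⟩
  by_contra! hlt
  refine hne (hrec (Finset.univ.filter fun p => c' p ≠ 0) (Nat.le_sub_one_of_lt hlt) c' hc' 0
    (Submodule.zero_mem _) fun p hp => ?_)
  simpa using hp

lemma isOptimalLRC_code (hδ : 1 ≤ δ) (hv : 1 ≤ v) (hvr : v ≤ r)
    (hd : minDist D.code = (r - v) + δ) : IsOptimalLRC D.code r δ := by
  refine ⟨D.hasInfoLocality_code hδ hvr, ?_⟩
  have hceil : ⌈((ℓ * r + v : ℕ) : ℚ) / (r : ℚ)⌉ = (ℓ : ℤ) + 1 := by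
    have hr : (0 : ℚ) < r := by exact_mod_cast (by omega : 0 < r)
    rw [Int.ceil_eq_iff]
    constructor
    · rw [lt_div_iff₀ hr]
      push_cast
      have : (1 : ℚ) ≤ v := by exact_mod_cast hv
      nlinarith
    · rw [div_le_iff₀ hr]
      push_cast
      have : (v : ℚ) ≤ r := by exact_mod_cast hvr
      nlinarith
  have hn : codeLength D.code = t * ρ := D.isLinearCode_code.1
  rw [hd, hn, D.finrank_code, hceil, ← D.card_cells]
  obtain ⟨h, rfl⟩ := Nat.exists_eq_add_of_le hvr
  obtain ⟨d, rfl⟩ := Nat.exists_eq_add_of_le hδ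
  rw [Nat.add_sub_cancel_left, Nat.add_sub_cancel_left]
  push_cast
  ring

/-- The second term of the minimum is the degree condition; the first contradicts `4u ≥ δ(δ + 1)`,
which holds for both values of `lam`. -/
lemma recoversColumnsAnd_of_inter_le {lam : ℕ} (hlam : lam = 1 ∨ lam = 2) (hδ : 1 ≤ δ)
    (hB : ∀ i j, i ≠ j → (D.B i ∩ D.B j).card ≤ lam) (y : ℕ) :
    RecoversColumnsAnd D.code y
      (min (((δ : ℤ) + 1) * δ / 2 - 2 * y - 1) (((r - v : ℕ) : ℤ) + δ - 1 - 2 * y)) := by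
  intro Y hY F hF
  by_contra hrec
  rw [le_min_iff] at hF
  obtain ⟨m, u, -, h2, h3, -⟩ := D.exists_entangled_of_not_recoverable hδ hB Y F (by omega) hrec
  have h4 : δ * (δ + 1) ≤ 2 * (2 * u) := by
    rcases hlam with rfl | rfl <;> nlinarith
  have h5 : ((δ : ℤ) + 1) * δ / 2 ≤ 2 * u :=
    Int.ediv_le_of_le_mul (by norm_num) (by push_cast [← @Nat.cast_le ℤ] at h4; linarith)
  omega

/-- Recovery when `h = r - v` is small compared with the overlaps of the blocks. -/
lemma recovers_of_inter_le {lam : ℕ} (hδ : 1 ≤ δ)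
    (hB : ∀ i j, i ≠ j → (D.B i ∩ D.B j).card ≤ lam)
    (hm : ∀ m, δ + lam ≤ lam * m → (r - v) + δ ≤ m * δ)
    (hu : ∀ u, δ * (δ + lam) ≤ 2 * lam * u → r - v ≤ 2 * u) :
    (∀ E : Finset (Fin t × Fin ρ), E.card ≤ (r - v) + δ - 1 →
      Recoverable D.code (E : Set (Fin t × Fin ρ))) ∧
    (∀ y : ℕ, y ≤ 2 →
      RecoversColumnsAnd D.code y (((r - v : ℕ) : ℤ) - 2 * y - 1)) ∧
    (∀ y : ℕ, RecoversColumnsAnd D.code y (((r - v : ℕ) : ℤ) - 2 - y.choose 2 - y)) := by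
  refine ⟨fun E hE => ?_, fun y _ Y hY F hF => ?_, fun y Y hY F hF => ?_⟩
  · by_contra hrec
    obtain ⟨m, u, h1, -, -, h4⟩ := D.exists_entangled_of_not_recoverable hδ hB ∅ E
      (by rw [Finset.card_empty]; omega) (by simpa using hrec)
    have := hm m h1
    have := h4 rfl
    omega
  · by_contra hrec
    obtain ⟨m, u, -, h2, h3, -⟩ := D.exists_entangled_of_not_recoverable hδ hB Y F (by omega) hrec
    have := hu u h2
    omega
  · have hy : y ≤ y.choose 2 + 1 := by
      rcases y with _ | y
      · omega
      · rw [Nat.choose_succ_succ', Nat.choose_one_right]; omega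
    by_contra hrec
    obtain ⟨m, u, -, h2, h3, -⟩ := D.exists_entangled_of_not_recoverable hδ hB Y F (by omega) hrec
    have := hu u h2
    omega

lemma optimal_and_gsd {lam : ℕ} (hlam : lam = 1 ∨ lam = 2) (hδ : 1 ≤ δ) (hv : 1 ≤ v) (hvr : v ≤ r)
    (hB : ∀ i j, i ≠ j → (D.B i ∩ D.B j).card ≤ lam)
    (hm : ∀ m, δ + lam ≤ lam * m → (r - v) + δ ≤ m * δ)
    (hu : ∀ u, δ * (δ + lam) ≤ 2 * lam * u → r - v ≤ 2 * u) :
    minDist D.code = (r - v) + δ ∧ IsOptimalLRC D.code r δ ∧ HasGSDItems D.code r δ (r - v) := by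
  obtain ⟨h1, h2, h3⟩ := D.recovers_of_inter_le hδ hB hm hu
  have hd := D.minDist_code hδ hv h1
  have ho := D.isOptimalLRC_code hδ hv hvr hd
  refine ⟨hd, ho, fun y γ hy hyt hγ => ⟨ho, ?_, ?_⟩, fun y γ hy hyt hγ => ⟨ho, ?_, ?_⟩,
    fun y γ hy hyt hγ => ⟨ho, ?_, ?_⟩⟩
  · rw [hγ]; exact h2 y hy
  · rw [hd, hγ]; push_cast; linarith
  · rw [hγ]; exact h3 y
  · rw [hd, hγ]; push_cast; linarith
  · rw [hγ]; exact D.recoversColumnsAnd_of_inter_le hlam hδ hB y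
  · rw [hd]; push_cast; linarith

omit [Field K] in
lemma inter_card_le_of_unique {lam : ℕ}
    (h : ∀ T ⊆ D.points, T.card = lam + 1 → ∀ B ∈ D.blocks, ∀ B' ∈ D.blocks,
      T ⊆ B → T ⊆ B' → B = B') (i j : Fin (ℓ + 1)) (hij : i ≠ j) :
    (D.B i ∩ D.B j).card ≤ lam := by
  by_contra! hlt
  obtain ⟨T, hT, hTc⟩ := Finset.exists_subset_card_eq (Nat.succ_le_of_lt hlt)
  rw [Finset.subset_inter_iff] at hT
  exact hij (D.B.injective (h T (hT.1.trans (D.B_subset i)) hTc _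
    (Finset.mem_map_of_mem _ (Finset.mem_univ i)) _ (Finset.mem_map_of_mem _ (Finset.mem_univ j))
    hT.1 hT.2))

omit [Field K] in
lemma inter_card_le_of_isPacking {lam b n : ℕ} (h : IsPacking (lam + 1) n b D.points D.blocks)
    (i j : Fin (ℓ + 1)) (hij : i ≠ j) : (D.B i ∩ D.B j).card ≤ lam :=
  D.inter_card_le_of_unique h.2.2.2 i j hij

lemma small_of_le_sq {h : ℕ} (hh : h ≤ δ ^ 2) :
    (∀ m, δ + 1 ≤ 1 * m → h + δ ≤ m * δ) ∧ ∀ u, δ * (δ + 1) ≤ 2 * 1 * u → h ≤ 2 * u :=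
  ⟨fun m hm => by nlinarith, fun u hu => by nlinarith⟩

/-- For `lam = 2`: `m ≥ ⌈δ/2⌉ + 1` and `2u ≥ δ(δ + 2)/2 ≥ ⌈δ/2⌉ δ`. -/
lemma small_of_le_ceil {h : ℕ} (hh : h ≤ ⌈(δ : ℚ) / 2⌉₊ * δ) :
    (∀ m, δ + 2 ≤ 2 * m → h + δ ≤ m * δ) ∧ ∀ u, δ * (δ + 2) ≤ 2 * 2 * u → h ≤ 2 * u := by
  have h1 : ⌈(δ : ℚ) / 2⌉₊ ≤ (δ + 1) / 2 := by
    rw [Nat.ceil_le, div_le_iff₀ (by norm_num)]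
    exact_mod_cast (by omega : δ ≤ (δ + 1) / 2 * 2)
  have h2 : h ≤ (δ + 1) / 2 * δ := hh.trans (Nat.mul_le_mul_right _ h1)
  constructor
  · intro m hm
    have : (δ + 1) / 2 + 1 ≤ m := by omega
    nlinarith
  · intro u hu
    have : (δ + 1) / 2 * 2 ≤ δ + 1 := Nat.div_mul_le_self _ _
    nlinarith

end RearrangedData

lemma IsSteiner.isPacking {P : Type*} {τ b n : ℕ} {X : Finset P} {𝓑 : Finset (Finset P)}
    (h : IsSteiner τ b n X 𝓑) : IsPacking τ n b X 𝓑 :=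
  ⟨h.1, h.2.1, h.2.2.1, fun T hT hc _ hB _ hB' hTB hTB' =>
    (h.2.2.2 T hT hc).unique ⟨hB, hTB⟩ ⟨hB', hTB'⟩⟩

/-! ### Placing the symbols in an array -/

section Arrangement

variable {K : Type*}

/-- The points removed from the last block must be the first ones in the enumeration. A bijection
between the initial indices and those landing in `H` extends to a permutation. -/
lemma exists_enumeration_starting_with {H X : Finset K} (hHX : H ⊆ X) :
    ∃ x : Fin X.card ↪ K, Finset.univ.map x = X ∧ ∀ a : Fin X.card, (a : ℕ) < H.card ↔ x a ∈ H := by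
  classical
  let e₀ := X.equivFin.symm
  have hc : Fintype.card {a : Fin X.card // (a : ℕ) < H.card} =
      Fintype.card {a : Fin X.card // (e₀ a : K) ∈ H} := by
    rw [Fintype.card_subtype, Fin.card_filter_val_lt, min_eq_right (Finset.card_le_card hHX),
      Fintype.card_subtype, ← Finset.card_map (e₀.toEmbedding.trans (Function.Embedding.subtype _))]
    congr 1
    ext z
    simp only [Finset.mem_map, Finset.mem_filter, Finset.mem_univ, true_and]
    constructor
    · intro hz
      exact ⟨e₀.symm ⟨z, hHX hz⟩, by simpa using hz, by simp⟩
    · rintro ⟨a, ha, rfl⟩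
      exact ha
  let e := Fintype.equivOfCardEq hc
  refine ⟨(e.extendSubtype.trans e₀).toEmbedding.trans (Function.Embedding.subtype _), ?_, ?_⟩
  · ext z
    simp only [Finset.mem_map, Finset.mem_univ, true_and]
    constructor
    · rintro ⟨a, rfl⟩
      exact (e₀ _).2
    · intro hz
      exact ⟨(e.extendSubtype.trans e₀).symm ⟨z, hz⟩, by simp⟩
  · exact fun a => ⟨fun ha => e.extendSubtype_mem a ha, fun ha => by
      by_contra h
      exact e.extendSubtype_not_mem a h ha⟩

/-- A map all of whose fibres have `t` elements is the column map of a `t`-row array; a partial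
section can be placed in the last row. -/
lemma exists_array_arrangement {ι : Type*} [Fintype ι] {t ρ h : ℕ} (col : ι → Fin ρ)
    (hcol : ∀ a, Nat.card {c // col c = a} = t) (p : Fin h → ι)
    (hp : ∀ i, (col (p i) : ℕ) = i) :
    ∃ cell : ι ≃ Fin t × Fin ρ, (∀ c, (cell c).2 = col c) ∧ ∀ i, ((cell (p i)).1 : ℕ) + 1 = t := by
  classical
  have he : ∀ a, ∃ e : {c // col c = a} ≃ Fin t,
      ∀ i (hi : col (p i) = a), (e ⟨p i, hi⟩ : ℕ) + 1 = t := by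
    intro a
    let e₀ := Finite.equivFinOfCardEq (hcol a)
    by_cases ha : ∃ i, col (p i) = a
    · obtain ⟨i, hi⟩ := ha
      have ht : 0 < t := (Nat.zero_le _).trans_lt (e₀ ⟨p i, hi⟩).isLt
      -- The fibre meets the section `p` only once, so one swap brings that element to the last row.
      refine ⟨e₀.trans (Equiv.swap (e₀ ⟨p i, hi⟩) ⟨t - 1, by omega⟩), fun j hj => ?_⟩
      have : j = i := Fin.ext (by rw [← hp, ← hp, hj, hi])
      subst this
      simp only [Equiv.trans_apply, Equiv.swap_apply_left]
      omega
    · exact ⟨e₀, fun i hi => absurd ⟨i, hi⟩ ha⟩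
  choose e he using he
  refine ⟨(Equiv.sigmaFiberEquiv col).symm.trans ((Equiv.sigmaCongrRight e).trans
    ((Equiv.sigmaEquivProd _ _).trans (Equiv.prodComm _ _))), fun c => rfl, fun i => he _ i rfl⟩

/-- Column `a` must hold one symbol for each of the `t` blocks through `x_a`. For a point removed
from the last block, the missing local symbol is replaced by a parity. -/
theorem exists_rearrangedData {ℓ r δ v t : ℕ} (hδ : 1 ≤ δ) (hvr : v ≤ r)
    (S X : Finset K) (𝓑 : Finset (Finset K)) (hS : S.card = r - v) (h𝓑 : 𝓑.card = ℓ + 1)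
    (hSX : Disjoint S X) (hB : ∀ B ∈ 𝓑, B ⊆ X ∧ B.card = r + δ - 1)
    (hreg : IsRegularSystem t X 𝓑) :
    ∃ D : RearrangedData K ℓ r δ v t X.card,
      D.points = X ∧ D.blocks = 𝓑 ∧ D.parityPoints = S := by
  classical
  let eB := (𝓑.equivFinOfCardEq h𝓑).symm
  let B : Fin (ℓ + 1) ↪ Finset K := eB.toEmbedding.trans (Function.Embedding.subtype _)
  have hBX : ∀ j, B j ⊆ X := fun j => (hB _ (eB j).2).1
  have hBc : ∀ j, (B j).card = r + δ - 1 := fun j => (hB _ (eB j).2).2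
  have hBmap : Finset.univ.map B = 𝓑 := by
    ext b
    simp only [Finset.mem_map, Finset.mem_univ, true_and]
    constructor
    · rintro ⟨j, rfl⟩; exact (eB j).2
    · intro hb; exact ⟨eB.symm ⟨b, hb⟩, by simp [B]⟩
  obtain ⟨H, hHB, hHc⟩ := Finset.exists_subset_card_eq
    (show r - v ≤ (B (Fin.last ℓ)).card by rw [hBc]; omega)
  obtain ⟨x, hx, hxH⟩ := exists_enumeration_starting_with (hHB.trans (hBX _))
  rw [hHc] at hxH
  let A : Fin (ℓ + 1) → Finset K := fun j => if j = Fin.last ℓ then B j \ H else B j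
  have hA : ∀ j, (A j).card = infoLen ℓ r v j + (δ - 1) := by
    intro j
    simp only [A, infoLen]
    split_ifs with hj
    · subst hj
      rw [Finset.card_sdiff_of_subset hHB, hBc, hHc]; omega
    · rw [hBc]; omega
  let eA := fun j => ((A j).equivFinOfCardEq (hA j)).symm
  let θ : (j : Fin (ℓ + 1)) → Fin (infoLen ℓ r v j + (δ - 1)) ↪ K := fun j =>
    (eA j).toEmbedding.trans (Function.Embedding.subtype _)
  have hθA : ∀ j, Set.range (θ j) = A j := by
    intro j
    ext z
    constructor
    · rintro ⟨i, rfl⟩; exact (eA j i).2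
    · intro hz; exact ⟨(eA j).symm ⟨z, hz⟩, by simp [θ]⟩
  have hAB : ∀ j, A j ⊆ B j := by
    intro j
    simp only [A]
    split_ifs
    · exact Finset.sdiff_subset
    · exact subset_rfl
  have hρ : r - v ≤ X.card := hHc ▸ Finset.card_le_card (hHB.trans (hBX _))
  have hxs : ∀ z ∈ X, ∃ a, x a = z := fun z hz => by
    rw [← hx] at hz; simpa using hz
  have hθX : ∀ j i, θ j i ∈ X := fun j i => hBX j (hAB j (eA j i).2)
  choose a ha using fun j i => hxs _ (hθX j i)
  let col : LRCCoord ℓ r δ v (r - v) → Fin X.card :=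
    Sum.elim (fun q => a q.1 q.2) fun i => ⟨i, by omega⟩
  have hcolB : ∀ c, x (col c) ∈ B (Sum.elim (fun q => q.1) (fun _ => Fin.last ℓ) c) := by
    rintro (⟨j, i⟩ | i)
    · simp only [col, Sum.elim_inl, ha]
      exact hAB j (eA j i).2
    · exact hHB ((hxH _).1 i.2)
  have hxX : ∀ b, x b ∈ X := fun b => by
    have := Finset.mem_map_of_mem x (Finset.mem_univ b)
    rwa [hx] at this
  have hdeg : ∀ b, Nat.card {j // x b ∈ B j} = t := by
    intro b
    rw [← hreg (x b) (hxX b), ← Nat.card_coe_set_eq]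
    refine Nat.card_congr ((eB.subtypeEquiv (q := fun b' => x b ∈ b'.1) fun j => Iff.rfl).trans ?_)
    exact Equiv.subtypeSubtypeEquivSubtypeInter (fun b' => b' ∈ 𝓑) fun b' => x b ∈ b'
  have hfib : ∀ b, Nat.card {c // col c = b} = t := by
    intro b
    let φ : {c // col c = b} → {j // x b ∈ B j} := fun c =>
      ⟨Sum.elim (fun q => q.1) (fun _ => Fin.last ℓ) c.1, by simpa only [c.2] using hcolB c.1⟩
    -- No local symbol of the last group sits at a removed point, so a parity and a local symbol of
    -- one column never go to the same block.
    have hnot : ∀ i (c : Fin (r - v)), x (col (Sum.inl ⟨Fin.last ℓ, i⟩)) ≠ x ⟨c, by omega⟩ := by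
      intro i c heq
      simp only [col, Sum.elim_inl, ha] at heq
      have h1 : θ (Fin.last ℓ) i ∈ A (Fin.last ℓ) := (eA _ i).2
      simp only [A, if_true, Finset.mem_sdiff] at h1
      refine h1.2 ?_
      rw [heq]
      exact (hxH _).1 c.2
    have hφ : Function.Bijective φ := by
      constructor
      · rintro ⟨⟨j, i⟩ | i, hc⟩ ⟨⟨j', i'⟩ | i', hc'⟩ hcc
        · have hj : j = j' := congrArg Subtype.val hcc
          subst hj
          have : θ j i = θ j i' := by
            rw [← ha, ← ha]
            exact congrArg x (hc.trans hc'.symm)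
          rw [Subtype.mk.injEq, (θ j).injective this]
        · have hj : j = Fin.last ℓ := congrArg Subtype.val hcc
          subst hj
          exact absurd (congrArg x (hc.trans hc'.symm)) (hnot i i')
        · have hj : Fin.last ℓ = j' := congrArg Subtype.val hcc
          subst hj
          exact absurd (congrArg x (hc'.trans hc.symm)) (hnot i' i)
        · have h1 : col (Sum.inr i) = col (Sum.inr i') := hc.trans hc'.symm
          have h2 : (i : ℕ) = i' := by simpa [col] using h1
          rw [Subtype.mk.injEq, Fin.ext h2]
      · rintro ⟨j, hj⟩
        by_cases hjA : x b ∈ A j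
        · have : x b ∈ Set.range (θ j) := by rw [hθA]; exact hjA
          obtain ⟨i, hi⟩ := this
          exact ⟨⟨Sum.inl ⟨j, i⟩, x.injective ((ha j i).trans hi)⟩, rfl⟩
        · have hjl : j = Fin.last ℓ := by
            by_contra hne
            exact hjA (by simpa only [A, if_neg hne] using hj)
          subst hjl
          have hbH : x b ∈ H := by
            by_contra hbH
            exact hjA (by simpa only [A, if_true, Finset.mem_sdiff] using ⟨hj, hbH⟩)
          exact ⟨⟨Sum.inr ⟨b, (hxH b).2 hbH⟩, rfl⟩, rfl⟩
    rw [Nat.card_eq_of_bijective φ hφ, hdeg]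
  obtain ⟨cell, hcell, hrow⟩ := exists_array_arrangement col hfib (fun i => Sum.inr i)
    fun i => rfl
  let eS := (S.equivFinOfCardEq hS).symm
  refine ⟨{
    s := eS.toEmbedding.trans (Function.Embedding.subtype _)
    x := x
    s_ne_x := fun i b h => Finset.disjoint_left.1 hSX (eS i).2 (by
      rw [← hx]; exact Finset.mem_map.2 ⟨b, Finset.mem_univ _, h.symm⟩)
    B := B
    B_subset := fun j => by rw [hx]; exact hBX j
    B_card := hBc
    regular := fun b => by rw [← Nat.card_coe_set_eq]; exact hdeg b
    removed_mem := fun b hb => hHB ((hxH b).1 hb)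
    θ := θ
    range_θ := fun j hj => by rw [hθA]; simp only [A, if_neg hj]
    range_θ_last := by
      rw [hθA]
      simp only [A, if_true, Finset.coe_sdiff]
      congr 1
      ext z
      constructor
      · intro hz
        obtain ⟨b, rfl⟩ := hxs z (hBX _ (hHB hz))
        exact ⟨b, (hxH b).2 hz, rfl⟩
      · rintro ⟨b, hb, rfl⟩
        exact (hxH b).1 hb
    cell := cell
    cell_local := fun j i => by rw [hcell]; exact ha j i
    cell_parity := fun i => ⟨hrow i, by rw [hcell]; rfl⟩ }, hx, hBmap, ?_⟩
  ext z
  simp only [RearrangedData.parityPoints, Finset.mem_map, Finset.mem_univ, true_and]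
  constructor
  · rintro ⟨j, rfl⟩; exact (eS j).2
  · intro hb; exact ⟨eS.symm ⟨z, hb⟩, by simp⟩

end Arrangement

/-! ### Regularity, block counts and transport of designs -/

section DesignCounting

variable {P Q : Type*} {τ b n t : ℕ} {X : Finset P} {𝓑 : Finset (Finset P)}

lemma ncard_blocks_through [DecidableEq P] (x : P) :
    {B | B ∈ 𝓑 ∧ x ∈ B}.ncard = (𝓑.filter fun B => x ∈ B).card := by
  rw [← Set.ncard_coe_finset]
  congr 1
  ext B
  simp

/-- Double count pairs of a `τ`-set `T` avoiding `x` and a block through `x` containing `T`: `T ∪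
{x}` lies in exactly one block. -/
lemma IsSteiner.isRegularSystem (h : IsSteiner (τ + 1) b n X 𝓑)
    (hpos : 0 < (b - 1).choose τ) (ht : t * (b - 1).choose τ = (n - 1).choose τ) :
    IsRegularSystem t X 𝓑 := by
  classical
  obtain ⟨_, hX, hB, hT⟩ := h
  intro x hx
  rw [ncard_blocks_through]
  refine Nat.eq_of_mul_eq_mul_right hpos (Eq.trans ?_ ht.symm)
  have h1 : ∀ T ∈ (X.erase x).powersetCard τ,
      ((𝓑.filter fun B => x ∈ B).filter fun B => T ⊆ B).card = 1 := by
    intro T hT'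
    rw [Finset.mem_powersetCard, Finset.subset_erase] at hT'
    obtain ⟨B, ⟨hB1, hB2⟩, huniq⟩ := hT (insert x T) (Finset.insert_subset hx hT'.1.1) (by
      rw [Finset.card_insert_of_notMem hT'.1.2, hT'.2])
    rw [Finset.card_eq_one]
    refine ⟨B, Finset.ext fun B' => ?_⟩
    rw [Finset.insert_subset_iff] at hB2
    simp only [Finset.mem_filter, Finset.mem_singleton]
    constructor
    · rintro ⟨⟨h2, h3⟩, h4⟩
      exact huniq B' ⟨h2, Finset.insert_subset h3 h4⟩
    · rintro rfl
      exact ⟨⟨hB1, hB2.1⟩, hB2.2⟩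
  have h2 : ∀ B ∈ 𝓑.filter fun B => x ∈ B,
      (((X.erase x).powersetCard τ).filter fun T => T ⊆ B).card = (b - 1).choose τ := by
    intro B hB'
    rw [Finset.mem_filter] at hB'
    obtain ⟨hBX, hBc⟩ := hB B hB'.1
    rw [← hBc, ← Finset.card_erase_of_mem hB'.2, ← Finset.card_powersetCard]
    congr 1
    ext T
    simp only [Finset.mem_filter, Finset.mem_powersetCard, Finset.subset_erase]
    constructor
    · rintro ⟨⟨⟨_, h3⟩, h4⟩, h5⟩
      exact ⟨⟨h5, h3⟩, h4⟩
    · rintro ⟨⟨h5, h3⟩, h4⟩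
      exact ⟨⟨⟨h5.trans hBX, h3⟩, h4⟩, h5⟩
  have h3 := Finset.sum_card_bipartiteAbove_eq_sum_card_bipartiteBelow
    (s := (X.erase x).powersetCard τ) (t := 𝓑.filter fun B => x ∈ B) (fun T B => T ⊆ B)
  simp only [Finset.bipartiteAbove, Finset.bipartiteBelow] at h3
  rw [Finset.sum_congr rfl h1, Finset.sum_congr rfl h2, Finset.sum_const, Finset.sum_const,
    Finset.card_powersetCard, Finset.card_erase_of_mem hx, hX, smul_eq_mul, smul_eq_mul,
    mul_one] at h3
  exact h3.symm

lemma IsRegularSystem.card_mul (h : IsRegularSystem t X 𝓑)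
    (hB : ∀ B ∈ 𝓑, B ⊆ X ∧ B.card = b) : 𝓑.card * b = X.card * t := by
  classical
  have h3 := Finset.sum_card_bipartiteAbove_eq_sum_card_bipartiteBelow
    (s := X) (t := 𝓑) (fun x B => x ∈ B)
  simp only [Finset.bipartiteAbove, Finset.bipartiteBelow] at h3
  rw [Finset.sum_const_nat fun x hx => (ncard_blocks_through x).symm.trans (h x hx),
    Finset.sum_const_nat (m := b) fun B hB' => ?_] at h3
  · exact h3.symm
  · rw [← (hB B hB').2]
    congr 1
    ext x
    simp only [Finset.mem_filter, and_iff_right_iff_imp]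
    exact fun hx => (hB B hB').1 hx

lemma IsSteiner.map (f : P ↪ Q) (h : IsSteiner τ b n X 𝓑) :
    IsSteiner τ b n (X.map f) (𝓑.map (Finset.mapEmbedding f).toEmbedding) := by
  obtain ⟨hn, hX, hB, hT⟩ := h
  refine ⟨hn, by rw [Finset.card_map, hX], fun B hB' => ?_, fun T hTX hTc => ?_⟩
  · obtain ⟨B, h, rfl⟩ := Finset.mem_map.1 hB'
    exact ⟨Finset.map_subset_map.2 (hB B h).1, (Finset.card_map f).trans (hB B h).2⟩
  · obtain ⟨T, hT', rfl⟩ := Finset.subset_map_iff.1 hTX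
    rw [Finset.card_map] at hTc
    obtain ⟨B, ⟨h1, h2⟩, h3⟩ := hT T hT' hTc
    refine ⟨B.map f, ⟨Finset.mem_map.2 ⟨B, h1, rfl⟩, Finset.map_subset_map.2 h2⟩, ?_⟩
    rintro B' ⟨hB', hTB⟩
    obtain ⟨B', h4, rfl⟩ := Finset.mem_map.1 hB'
    rw [h3 B' ⟨h4, Finset.map_subset_map.1 hTB⟩]
    rfl

lemma IsPacking.map (f : P ↪ Q) (h : IsPacking τ n b X 𝓑) :
    IsPacking τ n b (X.map f) (𝓑.map (Finset.mapEmbedding f).toEmbedding) := by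
  obtain ⟨hn, hX, hB, hT⟩ := h
  refine ⟨hn, by rw [Finset.card_map, hX], fun B hB' => ?_, fun T hTX hTc B hB₁ B' hB₂ h1 h2 => ?_⟩
  · obtain ⟨B, h, rfl⟩ := Finset.mem_map.1 hB'
    exact ⟨Finset.map_subset_map.2 (hB B h).1, (Finset.card_map f).trans (hB B h).2⟩
  · obtain ⟨T, hT', rfl⟩ := Finset.subset_map_iff.1 hTX
    obtain ⟨B, h3, rfl⟩ := Finset.mem_map.1 hB₁
    obtain ⟨B', h4, rfl⟩ := Finset.mem_map.1 hB₂
    rw [hT T hT' (by rwa [Finset.card_map] at hTc) B h3 B' h4 (Finset.map_subset_map.1 h1)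
      (Finset.map_subset_map.1 h2)]

lemma IsRegularSystem.map (f : P ↪ Q) (h : IsRegularSystem t X 𝓑) :
    IsRegularSystem t (X.map f) (𝓑.map (Finset.mapEmbedding f).toEmbedding) := by
  classical
  intro z hz
  obtain ⟨x, hx, rfl⟩ := Finset.mem_map.1 hz
  rw [ncard_blocks_through, Finset.filter_map, Finset.card_map, ← h x hx, ncard_blocks_through]
  congr 1
  ext B
  simp

/-- A regular block system on any finite point set can be carried over to a large enough field. -/
lemma exists_rearrangedData_of_design {K : Type*} [Fintype K] [Fintype P] {ℓ r δ v : ℕ}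
    (hδ : 1 ≤ δ) (hvr : v ≤ r) (h𝓑 : 𝓑.card = ℓ + 1) (hP : Fintype.card P = n)
    (hB : ∀ B ∈ 𝓑, B.card = r + δ - 1) (hreg : IsRegularSystem t Finset.univ 𝓑)
    (hK : n + (r - v) ≤ Fintype.card K) :
    ∃ (f : P ↪ K) (D : RearrangedData K ℓ r δ v t n), D.points = Finset.univ.map f ∧
      D.blocks = 𝓑.map (Finset.mapEmbedding f).toEmbedding := by
  -- Embedding the disjoint sum chooses `X` and `S` together and keeps them disjoint.
  obtain ⟨g⟩ : Nonempty (P ⊕ Fin (r - v) ↪ K) :=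
    Function.Embedding.nonempty_of_card_le (by simpa [hP] using hK)
  let f : P ↪ K := Function.Embedding.inl.trans g
  obtain ⟨D, h1, h2, -⟩ := exists_rearrangedData (K := K) (ℓ := ℓ) hδ hvr
    (Finset.univ.map (Function.Embedding.inr.trans g)) (Finset.univ.map f)
    (𝓑.map (Finset.mapEmbedding f).toEmbedding) (by simp) (by rw [Finset.card_map, h𝓑]) (by
      rw [Finset.disjoint_left]
      intro z hz hz'
      obtain ⟨i, _, rfl⟩ := Finset.mem_map.1 hz
      obtain ⟨a, _, ha⟩ := Finset.mem_map.1 hz'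
      exact Sum.inl_ne_inr (g.injective ha)) (fun B hB' => by
      obtain ⟨B, h, rfl⟩ := Finset.mem_map.1 hB'
      exact ⟨Finset.map_subset_map.2 (Finset.subset_univ B),
        (Finset.card_map f).trans (hB B h)⟩) (hreg.map f)
  have hc : (Finset.univ.map f).card = n := by rw [Finset.card_map, Finset.card_univ, hP]
  clear_value f
  subst hc
  exact ⟨f, D, h1, h2⟩

lemma exists_rearrangedData_of_isSteiner {K : Type*} [Fintype K] [Fintype P] {ℓ r δ v : ℕ}
    (hδ : 1 ≤ δ) (hvr : v ≤ r) (h : IsSteiner (τ + 1) b n Finset.univ 𝓑) (hb : b = r + δ - 1)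
    (hb0 : 0 < b)     (hpos : 0 < (b - 1).choose τ) (ht : t * (b - 1).choose τ = (n - 1).choose τ)
    (hℓ : ℓ + 1 = n * t / b) (hK : n + (r - v) ≤ Fintype.card K) :
    ∃ D : RearrangedData K ℓ r δ v t n, IsSteiner (τ + 1) b n D.points D.blocks := by
  have hreg := h.isRegularSystem hpos ht
  have hcard := hreg.card_mul h.2.2.1
  have hn := h.1
  have hX := h.2.1
  rw [hX] at hcard
  obtain ⟨f, D, h1, h2⟩ := exists_rearrangedData_of_design hδ hvr
    (hℓ.trans (Nat.div_eq_of_eq_mul_left hb0 hcard.symm)).symm hX (fun B hB => (h.2.2.1 B hB).2.trans hb) hreg hK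
  exact ⟨D, by rw [h1, h2]; exact h.map f⟩

end DesignCounting

/-! ### Affine lines -/

section AffineGeometry

/-- The lines of an affine space over `F` form a `2`-Steiner system. -/
theorem exists_isSteiner_affine (F V : Type*) [Field F] [Fintype F] [AddCommGroup V] [Module F V]
    [Fintype V] (hV : 2 ≤ Fintype.card V) :
    ∃ 𝓑 : Finset (Finset V), IsSteiner 2 (Fintype.card F) (Fintype.card V) Finset.univ 𝓑 := by
  classical
  let line : V → V → Finset V := fun x d => Finset.univ.image fun c : F => x + c • d
  refine ⟨((Finset.univ : Finset (V × V)).filter fun p => p.2 ≠ 0).image fun p => line p.1 p.2,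
    hV, Finset.card_univ, fun B hB => ⟨Finset.subset_univ B, ?_⟩, fun T _ hT => ?_⟩
  · obtain ⟨⟨x, d⟩, hd, rfl⟩ := Finset.mem_image.1 hB
    have hd : d ≠ 0 := (Finset.mem_filter.1 hd).2
    exact Finset.card_image_of_injective _ fun c c' h => smul_left_injective F hd (add_left_cancel h)
  · obtain ⟨a, b, hab, rfl⟩ := Finset.card_eq_two.1 hT
    refine ⟨line a (b - a), ⟨Finset.mem_image.2 ⟨(a, b - a), by
      simpa using sub_ne_zero.2 hab.symm, rfl⟩, ?_⟩, ?_⟩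
    · simp only [Finset.insert_subset_iff, Finset.singleton_subset_iff]
      exact ⟨Finset.mem_image.2 ⟨0, Finset.mem_univ _, by simp⟩,
        Finset.mem_image.2 ⟨1, Finset.mem_univ _, by simp⟩⟩
    · rintro B ⟨hB, hTB⟩
      obtain ⟨⟨x, d⟩, -, rfl⟩ := Finset.mem_image.1 hB
      simp only [Finset.insert_subset_iff, Finset.singleton_subset_iff, line, Finset.mem_image,
        Finset.mem_univ, true_and] at hTB
      obtain ⟨⟨c₁, rfl⟩, c₂, rfl⟩ := hTB
      -- The line is reparametrised so that the parameters `c₁, c₂` become `0, 1`.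
      have hc : c₂ - c₁ ≠ 0 := fun h => hab (by rw [sub_eq_zero.1 h])
      ext z
      simp only [line, Finset.mem_image, Finset.mem_univ, true_and]
      constructor
      · rintro ⟨c, rfl⟩
        refine ⟨(c - c₁) / (c₂ - c₁), ?_⟩
        rw [add_sub_add_left_eq_sub, ← sub_smul, smul_smul, div_mul_cancel₀ _ hc, sub_smul]
        abel
      · rintro ⟨c, rfl⟩
        refine ⟨c₁ + c * (c₂ - c₁), ?_⟩
        rw [add_sub_add_left_eq_sub, ← sub_smul, smul_smul, add_smul, add_assoc]

end AffineGeometry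

/-! ### Projective lines -/

section ProjectiveGeometry

open scoped LinearAlgebra.Projectivization

variable {F V : Type*} [Field F] [AddCommGroup V] [Module F V]

lemma finrank_sup_of_ne [FiniteDimensional F V] {p q : ℙ F V} (h : p ≠ q) :
    Module.finrank F (p.submodule ⊔ q.submodule : Submodule F V) = 2 := by
  have h1 := Submodule.finrank_sup_add_finrank_inf_eq p.submodule q.submodule
  rw [p.finrank_submodule, q.finrank_submodule] at h1
  have h2 : Module.finrank F (p.submodule ⊓ q.submodule : Submodule F V) ≤ 1 :=
    (Submodule.finrank_mono inf_le_left).trans_eq p.finrank_submodule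
  have h3 : Module.finrank F (p.submodule ⊓ q.submodule : Submodule F V) ≠ 1 := by
    intro h3
    have h4 := Submodule.eq_of_le_of_finrank_eq (inf_le_left (a := p.submodule) (b := q.submodule))
      (h3.trans p.finrank_submodule.symm)
    have h5 := Submodule.eq_of_le_of_finrank_eq (inf_le_right (a := p.submodule) (b := q.submodule))
      (h3.trans q.finrank_submodule.symm)
    exact h (Projectivization.submodule_injective (h4.symm.trans h5))
  omega

/-- The lines of a projective space over `F` form a `2`-Steiner system. -/
theorem exists_isSteiner_projective (F V : Type*) [Field F] [Fintype F] [AddCommGroup V]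
    [Module F V] [Finite V] [Fintype (ℙ F V)] (hV : 2 ≤ Fintype.card (ℙ F V)) :
    ∃ 𝓑 : Finset (Finset (ℙ F V)),
      IsSteiner 2 (Fintype.card F + 1) (Fintype.card (ℙ F V)) Finset.univ 𝓑 := by
  classical
  let line : Submodule F V → Finset (ℙ F V) := fun W =>
    Finset.univ.filter fun p => p.submodule ≤ W
  refine ⟨(Set.toFinite {B | ∃ W : Submodule F V, Module.finrank F W = 2 ∧ line W = B}).toFinset,
    hV, Finset.card_univ, fun B hB => ⟨Finset.subset_univ B, ?_⟩, fun T _ hT => ?_⟩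
  · rw [Set.Finite.mem_toFinset] at hB
    obtain ⟨W, hW, rfl⟩ := hB
    rw [← Nat.card_eq_fintype_card (α := F), ← Projectivization.card_of_finrank_two F W hW,
      ← Set.ncard_coe_finset, ← Nat.card_coe_set_eq]
    symm
    refine Nat.card_eq_of_bijective (fun p => ⟨Projectivization.map W.subtype
      W.injective_subtype p, ?_⟩) ⟨fun p q hpq => ?_, ?_⟩
    · induction p with
      | h w hw => simp [line, Projectivization.map_mk, Projectivization.submodule_mk]
    · exact Projectivization.map_injective _ W.injective_subtype (congrArg Subtype.val hpq)
    · rintro ⟨p, hp⟩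
      have hp : p.submodule ≤ W := by simpa [line] using hp
      induction p with
      | h w hw =>
        rw [Projectivization.submodule_mk, Submodule.span_singleton_le_iff_mem] at hp
        exact ⟨Projectivization.mk F ⟨w, hp⟩ (fun h => hw (congrArg Subtype.val h)), rfl⟩
  · obtain ⟨p, q, hpq, rfl⟩ := Finset.card_eq_two.1 hT
    have hsup := finrank_sup_of_ne hpq
    refine ⟨line (p.submodule ⊔ q.submodule), ⟨(Set.Finite.mem_toFinset _).2 ⟨_, hsup, rfl⟩, ?_⟩, ?_⟩
    · simp [Finset.insert_subset_iff, line]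
    · rintro B ⟨hB, hTB⟩
      rw [Set.Finite.mem_toFinset] at hB
      obtain ⟨W, hW, rfl⟩ := hB
      simp only [Finset.insert_subset_iff, Finset.singleton_subset_iff, line, Finset.mem_filter,
        Finset.mem_univ, true_and] at hTB
      rw [Submodule.eq_of_le_of_finrank_eq (sup_le hTB.1 hTB.2) (hsup.trans hW.symm)]

end ProjectiveGeometry

/-! ### Sublines of a projective line -/

section SphericalGeometry

open OnePoint Matrix

variable {L : Type*} [Field L] [DecidableEq L]

lemma exists_smul_eq_frame {a b c : OnePoint L} (hab : a ≠ b) (hac : a ≠ c) (hbc : b ≠ c) :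
    ∃ g : GL (Fin 2) L, g • ∞ = a ∧ g • ((0 : L) : OnePoint L) = b ∧
      g • ((1 : L) : OnePoint L) = c := by
  suffices h : ∃ g : GL (Fin 2) L, g • a = ∞ ∧ g • b = ((0 : L) : OnePoint L) ∧
      g • c = ((1 : L) : OnePoint L) by
    obtain ⟨g, h1, h2, h3⟩ := h
    exact ⟨g⁻¹, by rw [← h1, inv_smul_smul], by rw [← h2, inv_smul_smul],
      by rw [← h3, inv_smul_smul]⟩
  have h1 : ∃ g : GL (Fin 2) L, g • a = ∞ := by
    induction a using OnePoint.rec with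
    | infty => exact ⟨1, one_smul _ _⟩
    | coe k =>
      -- The map `x ↦ 1 / (x - k)`.
      refine ⟨GeneralLinearGroup.mkOfDetNeZero !![0, 1; 1, -k] (by simp [det_fin_two]), ?_⟩
      rw [smul_some_eq_ite, if_pos]
      simp [GeneralLinearGroup.mkOfDetNeZero]
  obtain ⟨g, hg⟩ := h1
  have hb : g • b ≠ ∞ := fun h => hab (MulAction.injective g (hg.trans h.symm))
  have hc : g • c ≠ ∞ := fun h => hac (MulAction.injective g (hg.trans h.symm))
  have hbc' : g • b ≠ g • c := fun h => hbc (MulAction.injective g h)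
  obtain ⟨b', hb'⟩ := OnePoint.ne_infty_iff_exists.1 hb
  obtain ⟨c', hc'⟩ := OnePoint.ne_infty_iff_exists.1 hc
  have hne : c' - b' ≠ 0 := by
    rw [← hb', ← hc'] at hbc'
    exact sub_ne_zero.2 fun h => hbc' (by rw [h])
  -- The map `x ↦ (x - b') / (c' - b')` fixes `∞` and sends `b', c'` to `0, 1`.
  refine ⟨GeneralLinearGroup.mkOfDetNeZero !![1, -b'; 0, c' - b']
    (by simpa [det_fin_two] using hne) * g, ?_, ?_, ?_⟩
  · rw [mul_smul, hg, smul_infty_eq_self_iff]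
    simp [GeneralLinearGroup.mkOfDetNeZero]
  · rw [mul_smul, ← hb', smul_some_eq_ite, if_neg (by
      simpa [GeneralLinearGroup.mkOfDetNeZero] using hne)]
    simp [GeneralLinearGroup.mkOfDetNeZero]
  · rw [mul_smul, ← hc', smul_some_eq_ite, if_neg (by
      simpa [GeneralLinearGroup.mkOfDetNeZero] using hne)]
    congr 1
    simp only [GeneralLinearGroup.mkOfDetNeZero]
    simp [← sub_eq_add_neg, div_self hne]

/-- Fixing `∞`, `0` and `1` makes the matrix successively triangular, diagonal and scalar. -/
lemma smul_eq_self_of_frame {g : GL (Fin 2) L} (h1 : g • (∞ : OnePoint L) = ∞)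
    (h2 : g • ((0 : L) : OnePoint L) = ((0 : L) : OnePoint L))
    (h3 : g • ((1 : L) : OnePoint L) = ((1 : L) : OnePoint L)) (x : OnePoint L) : g • x = x := by
  rw [smul_infty_eq_self_iff] at h1
  rw [smul_some_eq_ite] at h2 h3
  simp only [h1, mul_zero, zero_add, mul_one] at h2 h3
  split_ifs at h2 h3 with h0
  · exact absurd h2 (OnePoint.infty_ne_coe _)
  rw [OnePoint.coe_eq_coe] at h2 h3
  have h4 := (div_eq_zero_iff.1 h2).resolve_right h0
  rw [h4, add_zero] at h3
  induction x using OnePoint.rec with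
  | infty => rwa [smul_infty_eq_self_iff]
  | coe k =>
    rw [smul_some_eq_ite, h1, h4, zero_mul, zero_add, if_neg h0, add_zero, mul_div_right_comm, h3,
      one_mul]

lemma smul_eq_smul_of_frame {g g' : GL (Fin 2) L} (h1 : g • (∞ : OnePoint L) = g' • ∞)
    (h2 : g • ((0 : L) : OnePoint L) = g' • ((0 : L) : OnePoint L))
    (h3 : g • ((1 : L) : OnePoint L) = g' • ((1 : L) : OnePoint L)) (x : OnePoint L) :
    g • x = g' • x := by
  have := smul_eq_self_of_frame (g := g'⁻¹ * g) (by rw [mul_smul, h1, inv_smul_smul])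
    (by rw [mul_smul, h2, inv_smul_smul]) (by rw [mul_smul, h3, inv_smul_smul]) x
  rwa [mul_smul, inv_smul_eq_iff] at this

lemma card_onePoint (M : Type*) [Fintype M] [Fintype (OnePoint M)] :
    Fintype.card (OnePoint M) = Fintype.card M + 1 := by
  rw [← Fintype.card_option]
  exact Fintype.card_congr (Equiv.refl _)

/-- The images of the subline over `F` under `GL₂(L)` form a `3`-Steiner system. -/
theorem exists_isSteiner_spherical (F L : Type*) [Field F] [Fintype F] [Field L] [Fintype L]
    (φ : F →+* L) [Fintype (OnePoint L)] :
    ∃ 𝓑 : Finset (Finset (OnePoint L)),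
      IsSteiner 3 (Fintype.card F + 1) (Fintype.card L + 1) Finset.univ 𝓑 := by
  classical
  have : Fintype (OnePoint F) := inferInstanceAs (Fintype (Option F))
  let block : GL (Fin 2) L → Finset (OnePoint L) := fun g =>
    Finset.univ.image fun x : OnePoint F => g • x.map φ
  have hφ : Function.Injective (OnePoint.map φ) := Option.map_injective φ.injective
  have hmem : ∀ g x, g • OnePoint.map φ x ∈ block g := fun g x =>
    Finset.mem_image_of_mem _ (Finset.mem_univ x)
  -- `GL₂(F)` permutes the points of the subline.
  have hblock : ∀ g (u : GL (Fin 2) F), block (g * u.map φ) = block g := by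
    intro g u
    ext z
    simp only [block, Finset.mem_image, Finset.mem_univ, true_and, mul_smul, ← OnePoint.map_smul]
    constructor
    · rintro ⟨x, rfl⟩; exact ⟨u • x, rfl⟩
    · rintro ⟨x, rfl⟩; exact ⟨u⁻¹ • x, by rw [smul_inv_smul]⟩
  refine ⟨Finset.univ.image block, ?_, by rw [Finset.card_univ, card_onePoint],
    fun B hB => ⟨Finset.subset_univ B, ?_⟩, fun T _ hT => ?_⟩
  · have := Fintype.card_pos (α := L)
    omega
  · obtain ⟨g, -, rfl⟩ := Finset.mem_image.1 hB
    rw [← card_onePoint F, ← Finset.card_univ]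
    exact Finset.card_image_of_injective _ ((MulAction.injective g).comp hφ)
  · obtain ⟨a, b, c, hab, hac, hbc, rfl⟩ := Finset.card_eq_three.1 hT
    obtain ⟨g, rfl, rfl, rfl⟩ := exists_smul_eq_frame hab hac hbc
    refine ⟨block g, ⟨Finset.mem_image_of_mem _ (Finset.mem_univ g), ?_⟩, ?_⟩
    · simp only [Finset.insert_subset_iff, Finset.singleton_subset_iff]
      refine ⟨hmem g ∞, ?_, ?_⟩
      · simpa using hmem g ((0 : F) : OnePoint F)
      · simpa using hmem g ((1 : F) : OnePoint F)
    · rintro B ⟨hB, hTB⟩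
      obtain ⟨g', -, rfl⟩ := Finset.mem_image.1 hB
      simp only [Finset.insert_subset_iff, Finset.singleton_subset_iff, block, Finset.mem_image,
        Finset.mem_univ, true_and] at hTB
      obtain ⟨⟨x, hx⟩, ⟨y, hy⟩, ⟨z, hz⟩⟩ := hTB
      -- Some `u` over `F` carries the standard frame to the preimages of the three points; then `g'
      -- * u` and `g` agree on the frame, hence everywhere.
      obtain ⟨u, rfl, rfl, rfl⟩ := exists_smul_eq_frame (a := x) (b := y) (c := z)
        (by rintro rfl; exact hab (hx.symm.trans hy)) (by rintro rfl; exact hac (hx.symm.trans hz))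
        (by rintro rfl; exact hbc (hy.symm.trans hz))
      rw [OnePoint.map_smul, ← mul_smul] at hx hy hz
      rw [OnePoint.map_some, map_zero] at hy
      rw [OnePoint.map_some, map_one] at hz
      rw [OnePoint.map_infty] at hx
      rw [← hblock g' u]
      exact Finset.image_congr fun w _ => smul_eq_smul_of_frame hx hy hz _

end SphericalGeometry

/-! ### Packings by graphs of affine maps -/

section TransversalPacking

/-- The graphs of the maps `k ↦ a * w k + b`, where `a` ranges over a given set and differences of
values of `w` are units, form a regular packing. -/
theorem exists_isPacking_graphs {R : Type*} [CommRing R] [Fintype R] {e : ℕ} (he : 2 ≤ e)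
    (w : Fin e → R) (hw : ∀ i j, i ≠ j → IsUnit (w i - w j)) (A : Finset R) :
    ∃ 𝓑 : Finset (Finset (Fin e × R)),
      IsPacking 2 (e * Fintype.card R) e Finset.univ 𝓑 ∧
      IsRegularSystem A.card Finset.univ 𝓑 := by
  classical
  let block : R × R → Finset (Fin e × R) := fun p =>
    Finset.univ.image fun k => (k, p.1 * w k + p.2)
  have hmem : ∀ p k x, (k, x) ∈ block p ↔ p.1 * w k + p.2 = x := by
    intro p k x
    simp only [block, Finset.mem_image, Finset.mem_univ, true_and, Prod.mk.injEq]
    constructor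
    · rintro ⟨k, rfl, h⟩; exact h
    · intro h; exact ⟨k, rfl, h⟩
  -- Points with different first coordinates determine the slope, because `w k - w k'` is a unit,
  -- and then the constant term.
  have huniq : ∀ p q k x k' x', k ≠ k' → (k, x) ∈ block p → (k', x') ∈ block p →
      (k, x) ∈ block q → (k', x') ∈ block q → p = q := by
    rintro ⟨a, b⟩ ⟨a', b'⟩ k x k' x' hkk h1 h2 h3 h4
    rw [hmem] at h1 h2 h3 h4
    simp only at h1 h2 h3 h4
    have h5 : a * (w k - w k') = a' * (w k - w k') := by
      linear_combination h1 - h2 - h3 + h4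
    have h6 := (hw k k' hkk).mul_left_injective h5
    subst h6
    rw [← h3] at h1
    rw [add_left_cancel h1]
  refine ⟨(A ×ˢ Finset.univ).image block, ⟨?_, by simp, fun B hB => ⟨Finset.subset_univ B, ?_⟩,
    fun T _ hT B hB B' hB' hTB hTB' => ?_⟩, fun z _ => ?_⟩
  · have := Fintype.card_pos (α := R)
    nlinarith
  · obtain ⟨p, -, rfl⟩ := Finset.mem_image.1 hB
    rw [Finset.card_image_of_injective _ fun k k' h => (Prod.ext_iff.1 h).1, Finset.card_univ,
      Fintype.card_fin]
  · obtain ⟨⟨k, x⟩, ⟨k', x'⟩, hne, rfl⟩ := Finset.card_eq_two.1 hT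
    obtain ⟨p, -, rfl⟩ := Finset.mem_image.1 hB
    obtain ⟨q, -, rfl⟩ := Finset.mem_image.1 hB'
    simp only [Finset.insert_subset_iff, Finset.singleton_subset_iff] at hTB hTB'
    have hkk : k ≠ k' := by
      rintro rfl
      refine hne ?_
      rw [← (hmem _ _ _).1 hTB.1, ← (hmem _ _ _).1 hTB.2]
    rw [huniq p q k x k' x' hkk hTB.1 hTB.2 hTB'.1 hTB'.2]
  · obtain ⟨k, x⟩ := z
    rw [ncard_blocks_through]
    symm
    -- Through `(k, x)` there is one block for each slope; a second coordinate `k'`, available since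
    -- `e ≥ 2`, shows that different slopes give different blocks.
    refine Finset.card_bij (fun a _ => block (a, x - a * w k)) (fun a ha => ?_)
      (fun a _ a' _ h => ?_) fun B hB => ?_
    · rw [Finset.mem_filter, hmem]
      exact ⟨Finset.mem_image_of_mem _ (by simpa using ha), by ring⟩
    · have : Nontrivial (Fin e) := Fin.nontrivial_iff_two_le.2 he
      obtain ⟨k', hk'⟩ := exists_ne k
      have h1 : ∀ a, (k, x) ∈ block (a, x - a * w k) := fun a => (hmem _ _ _).2 (by ring)
      have h2 : (k', a * w k' + (x - a * w k)) ∈ block (a, x - a * w k) := (hmem _ _ _).2 rfl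
      exact congrArg Prod.fst (huniq _ _ _ _ _ _ hk'.symm (h1 a) h2 (h1 a') (h ▸ h2))
    · rw [Finset.mem_filter] at hB
      obtain ⟨hB, hz⟩ := hB
      obtain ⟨⟨a, b⟩, hab, rfl⟩ := Finset.mem_image.1 hB
      rw [hmem] at hz
      refine ⟨a, by simpa using hab, ?_⟩
      rw [← hz, add_sub_cancel_left]

end TransversalPacking

/-! ### Bertrand's postulate, cardinalities and finite fields -/

section Parameters

lemma exists_prime_between {m M : ℕ} (hM : 0 < M) (h : m ≤ M) :
    ∃ q : ℕ, q.Prime ∧ m ≤ q ∧ q ≤ 2 * M := by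
  obtain ⟨q, hq, h1, h2⟩ := Nat.exists_prime_lt_and_le_two_mul M hM.ne'
  exact ⟨q, hq, h.trans h1.le, h2⟩

lemma div_mul_sub_one (q β : ℕ) : (q ^ β - 1) / (q - 1) * (q - 1) = q ^ β - 1 :=
  Nat.div_mul_cancel (by simpa using Nat.sub_dvd_pow_sub_pow q 1 β)

/-- Each line through a fixed point contributes `q` further points. -/
lemma projective_card_eq {q : ℕ} (hq : 2 ≤ q) (β : ℕ) :
    (q ^ (β + 1) - 1) / (q - 1) = (q ^ β - 1) / (q - 1) * q + 1 := by
  refine Nat.div_eq_of_eq_mul_left (by omega) ?_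
  have h1 := div_mul_sub_one q β
  obtain ⟨s, rfl⟩ := Nat.exists_eq_add_of_le hq
  have h2 : 0 < (2 + s) ^ β := by positivity
  rw [add_mul, mul_assoc, mul_comm (2 + s) (2 + s - 1), ← mul_assoc, h1, pow_succ]
  generalize (2 + s) ^ β = N at *
  obtain ⟨M, rfl⟩ := Nat.exists_eq_add_of_lt h2
  have : (0 + M + 1) * (2 + s) = M * (2 + s) + 1 * (2 + s - 1) + 1 := by
    rw [show 2 + s - 1 = s + 1 by omega]; ring
  rw [this]
  simp

lemma choose_two_mul_two (n : ℕ) : n.choose 2 * 2 = n * (n - 1) := by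
  rw [Nat.choose_two_right, Nat.div_mul_cancel (Nat.even_mul_pred_self n).two_dvd]

lemma choose_two_dvd {q β : ℕ} (hβ : β ≠ 0) : q.choose 2 ∣ (q ^ β).choose 2 := by
  refine Nat.dvd_of_mul_dvd_mul_right (by norm_num : 0 < 2) ?_
  rw [choose_two_mul_two, choose_two_mul_two]
  exact mul_dvd_mul (dvd_pow_self q hβ) (by simpa using Nat.sub_dvd_pow_sub_pow q 1 β)

lemma projective_card_le {q : ℕ} (hq : 2 ≤ q) (β : ℕ) :
    (q ^ (β + 1) - 1) / (q - 1) ≤ 2 * q ^ β := by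
  rw [projective_card_eq hq]
  have h1 := div_mul_sub_one q β
  have h2 : 0 < q ^ β := by positivity
  obtain ⟨s, rfl⟩ := Nat.exists_eq_add_of_le hq
  rw [show 2 + s - 1 = s + 1 by omega] at *
  have : (2 + s) ^ β = ((2 + s) ^ β - 1) / (s + 1) * (s + 1) + 1 := by omega
  nlinarith [Nat.zero_le (((2 + s) ^ β - 1) / (s + 1) * s)]

lemma exists_field_of_isPrimePow {q : ℕ} (hq : IsPrimePow q) :
    ∃ (F : Type) (_ : Field F) (_ : Fintype F), Fintype.card F = q := by
  obtain ⟨p, k, hp, hk, rfl⟩ := hq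
  have := Fact.mk hp.nat_prime
  have := Fintype.ofFinite (GaloisField p k)
  exact ⟨GaloisField p k, inferInstance, inferInstance, by
    rw [← Nat.card_eq_fintype_card, GaloisField.card p k hk.ne']⟩

lemma exists_field_extension (F : Type) [Field F] [Fintype F] {β : ℕ} (hβ : β ≠ 0) :
    ∃ (L : Type) (_ : Field L) (_ : Fintype L) (_ : F →+* L),
      Fintype.card L = Fintype.card F ^ β := by
  obtain ⟨p, hp⟩ := CharP.exists F
  have := Fact.mk (CharP.char_is_prime F p)
  have := NeZero.mk hβ
  have := Fintype.ofFinite (FiniteField.Extension F p β)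
  exact ⟨FiniteField.Extension F p β, inferInstance, inferInstance, algebraMap _ _, by
    rw [← Nat.card_eq_fintype_card, ← Nat.card_eq_fintype_card, FiniteField.natCard_extension]⟩

end Parameters

/-! ### The four families of arrays -/

section Instances

variable {K : Type*} [Fintype K] {ℓ r δ v q β : ℕ}

theorem exists_rearrangedData_affine (hq : IsPrimePow q) (hβ : 2 ≤ β) (hδ : 2 ≤ δ)
    (hqr : q = r + δ - 1) (hvr : v ≤ r)
    (hℓ : ℓ + 1 = q ^ (β - 1) * (q ^ β - 1) / (q - 1))
    (hK : q ^ β + (r - v) ≤ Fintype.card K) :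
    ∃ D : RearrangedData K ℓ r δ v ((q ^ β - 1) / (q - 1)) (q ^ β),
      IsSteiner 2 q (q ^ β) D.points D.blocks := by
  obtain ⟨F, _, _, hF⟩ := exists_field_of_isPrimePow hq
  have hq2 := hq.two_le
  have hV : Fintype.card (Fin β → F) = q ^ β := by simp [hF]
  have hN : q ≤ q ^ β := Nat.le_self_pow (by omega) q
  obtain ⟨𝓑, h𝓑⟩ := exists_isSteiner_affine F (Fin β → F) (by rw [hV]; omega)
  rw [hV, hF] at h𝓑
  have hdiv : q - 1 ∣ q ^ β - 1 := by simpa using Nat.sub_dvd_pow_sub_pow q 1 β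
  refine exists_rearrangedData_of_isSteiner (by omega) hvr h𝓑 hqr (by omega) (by simp; omega)
    (by simpa using div_mul_sub_one q β) ?_ hK
  rw [hℓ, Nat.mul_div_assoc _ hdiv, eq_comm]
  refine Nat.div_eq_of_eq_mul_left (by omega) ?_
  nth_rw 1 [show β = β - 1 + 1 by omega]
  rw [pow_succ]
  ring

theorem exists_rearrangedData_projective (hq : IsPrimePow q) (hβ : 2 ≤ β) (hδ : 2 ≤ δ)
    (hqr : q + 1 = r + δ - 1) (hvr : v ≤ r)
    (hℓ : ℓ + 1 = (q ^ (β + 1) - 1) * (q ^ β - 1) / ((q - 1) * (q ^ 2 - 1)))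
    (hK : (q ^ (β + 1) - 1) / (q - 1) + (r - v) ≤ Fintype.card K) :
    ∃ D : RearrangedData K ℓ r δ v ((q ^ β - 1) / (q - 1)) ((q ^ (β + 1) - 1) / (q - 1)),
      IsSteiner 2 (q + 1) ((q ^ (β + 1) - 1) / (q - 1)) D.points D.blocks := by
  obtain ⟨F, _, _, hF⟩ := exists_field_of_isPrimePow hq
  have hq2 := hq.two_le
  have : Fintype (Projectivization F (Fin (β + 1) → F)) := Fintype.ofFinite _
  have hV : Fintype.card (Projectivization F (Fin (β + 1) → F)) =
      (q ^ (β + 1) - 1) / (q - 1) := by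
    rw [← Nat.card_eq_fintype_card, Projectivization.card'', Nat.card_eq_fintype_card,
      Nat.card_eq_fintype_card]
    simp [hF]
  have hN : q ≤ q ^ β := Nat.le_self_pow (by omega) q
  have hρ := projective_card_eq hq2 β
  have ht : 0 < (q ^ β - 1) / (q - 1) := Nat.div_pos (by omega) (by omega)
  obtain ⟨𝓑, h𝓑⟩ := exists_isSteiner_projective F (Fin (β + 1) → F) (by
    rw [hV, hρ]; nlinarith)
  rw [hV, hF] at h𝓑
  refine exists_rearrangedData_of_isSteiner (by omega) hvr h𝓑 hqr (by omega) (by simp; omega)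
    (by simp [hρ]) ?_ hK
  have h1 := div_mul_sub_one q β
  have h2 := div_mul_sub_one q (β + 1)
  have h3 : q ^ 2 - 1 = (q - 1) * (q + 1) := by
    rw [mul_comm, ← Nat.sq_sub_sq, one_pow]
  rw [hℓ, h3, ← mul_assoc]
  rw [← h1, ← h2, mul_mul_mul_comm, mul_comm (_ * _) ((q - 1) * (q - 1)),
    Nat.mul_div_mul_left _ _ (Nat.mul_pos (by omega) (by omega)),
    Nat.mul_div_cancel _ (by omega), Nat.mul_div_cancel _ (by omega)]

theorem exists_rearrangedData_spherical (hq : IsPrimePow q) (hβ : 2 ≤ β) (hδ : 2 ≤ δ)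
    (hqr : q + 1 = r + δ - 1) (hvr : v ≤ r)
    (hℓ : ℓ + 1 = (q ^ β + 1) * (q ^ β).choose 2 / ((q + 1) * q.choose 2))
    (hK : q ^ β + 1 + (r - v) ≤ Fintype.card K) :
    ∃ D : RearrangedData K ℓ r δ v ((q ^ β).choose 2 / q.choose 2) (q ^ β + 1),
      IsSteiner 3 (q + 1) (q ^ β + 1) D.points D.blocks := by
  obtain ⟨F, _, _, hF⟩ := exists_field_of_isPrimePow hq
  obtain ⟨L, _, _, φ, hL⟩ := exists_field_extension F (show β ≠ 0 by omega)
  rw [hF] at hL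
  have hq2 := hq.two_le
  have : Fintype (OnePoint L) := inferInstanceAs (Fintype (Option L))
  obtain ⟨𝓑, h𝓑⟩ := exists_isSteiner_spherical F L φ
  rw [hF, hL] at h𝓑
  have hpos : 0 < q.choose 2 := Nat.choose_pos hq2
  have hdvd : q.choose 2 ∣ (q ^ β).choose 2 := choose_two_dvd (by omega)
  refine exists_rearrangedData_of_isSteiner (by omega) hvr h𝓑 hqr (by omega) (by simpa using hpos)
    (by simpa using Nat.div_mul_cancel hdvd) ?_ hK
  rw [hℓ]
  nth_rw 1 [← Nat.div_mul_cancel hdvd]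
  rw [← mul_assoc, Nat.mul_div_mul_right _ _ hpos]

/-- Take for `R` the product of the fields of orders `p_i ^ m_i`. Each has more than `e - 1`
elements, so tuples `w_k` that differ in every coordinate exist, and their differences are units.
Any `P / e ^ u` slopes give the required regularity. -/
theorem exists_rearrangedData_cyclotomic {u : ℕ} {p m : Fin u → ℕ} {n₂ P e : ℕ}
    (hp : ∀ i, (p i).Prime) (hm : ∀ i, 0 < m i) (he : ∀ i, e ∣ p i ^ m i - 1)
    (hn₂ : n₂ = ∏ i, p i ^ m i) (hP : P = ∏ i, (p i ^ m i - 1)) (hδ : 2 ≤ δ)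
    (her : e = r + δ - 1) (hv : 1 ≤ v) (hvr : v ≤ r) (hℓ : ℓ + 1 = n₂ * P / e ^ u)
    (hK : e * n₂ + (r - v) ≤ Fintype.card K) :
    ∃ D : RearrangedData K ℓ r δ v (P / e ^ u) (e * n₂),
      IsPacking 2 (e * n₂) e D.points D.blocks := by
  have hfact := fun i => Fact.mk (hp i)
  let F : Fin u → Type := fun i => GaloisField (p i) (m i)
  have hF : ∀ i, Fintype (F i) := fun i => Fintype.ofFinite _
  have hFc : ∀ i, Fintype.card (F i) = p i ^ m i := fun i => by
    rw [← Nat.card_eq_fintype_card, GaloisField.card _ _ (hm i).ne']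
  have hR : Fintype.card (∀ i, F i) = n₂ := by rw [Fintype.card_pi, hn₂]; simp [hFc]
  have h1 : ∀ i, 1 < p i ^ m i := fun i => Nat.one_lt_pow (hm i).ne' (hp i).one_lt
  have hw : ∀ i, Nonempty (Fin e ↪ F i) := fun i => Function.Embedding.nonempty_of_card_le (by
    have := Nat.le_of_dvd (by have := h1 i; omega) (he i)
    rw [hFc, Fintype.card_fin]; omega)
  let w := fun i => (hw i).some
  have hdvd : e ^ u ∣ P := by
    rw [hP]
    simpa using Finset.prod_dvd_prod_of_dvd (fun _ : Fin u => e) _ fun i (_ : i ∈ Finset.univ) => he i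
  have hPn : P ≤ n₂ := by
    rw [hP, hn₂]
    exact Finset.prod_le_prod' fun i _ => Nat.sub_le _ _
  obtain ⟨A, -, hA⟩ := Finset.exists_subset_card_eq
    (s := (Finset.univ : Finset (∀ i, F i))) (n := P / e ^ u) (by
      rw [Finset.card_univ, hR]; exact (Nat.div_le_self _ _).trans hPn)
  obtain ⟨𝓑, h𝓑, hreg⟩ := exists_isPacking_graphs (by omega) (fun k i => w i k)
    (fun k k' hk => Pi.isUnit_iff.2 fun i =>
      (sub_ne_zero.2 fun h => hk ((w i).injective h)).isUnit) A
  rw [hA] at hreg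
  rw [hR] at h𝓑
  have hcard := hreg.card_mul h𝓑.2.2.1
  rw [h𝓑.2.1] at hcard
  obtain ⟨f, D, hD1, hD2⟩ := exists_rearrangedData_of_design (K := K) (ℓ := ℓ) (by omega) hvr
    (by
      rw [hℓ, Nat.mul_div_assoc _ hdvd]
      exact Nat.eq_of_mul_eq_mul_right (show 0 < e by omega) (by rw [hcard]; ring))
    (by simp [hR]) (fun B hB => (h𝓑.2.2.1 B hB).2.trans her) hreg hK
  exact ⟨D, by rw [hD1, hD2]; exact h𝓑.map f⟩

end Instances

/-! ### Asymptotic lengths -/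

section Lengths

/-- Bounds in terms of `N` turn into bounds in terms of any `κ` comparable with `N`. -/
lemma rpow_bounds_of_comparable {κ N lam α A B n : ℝ} (hN : 1 ≤ N) (h1 : N ≤ κ)
    (h2 : κ ≤ lam * N) (hα : 0 ≤ α) (hA : 0 ≤ A) (hB : 0 ≤ B) (hlow : A * N ^ α ≤ n)
    (hup : n ≤ B * N ^ α) :
    A / (max lam 1) ^ α * κ ^ α ≤ n ∧ n ≤ B * κ ^ α := by
  -- The maximum with 1 keeps the base positive for an arbitrary real `lam`.
  have hm : (0 : ℝ) < max lam 1 := lt_max_of_lt_right one_pos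
  constructor
  · refine le_trans ?_ hlow
    rw [div_mul_eq_mul_div, div_le_iff₀ (Real.rpow_pos_of_pos hm α), mul_assoc,
      ← Real.mul_rpow (by linarith) hm.le]
    refine mul_le_mul_of_nonneg_left (Real.rpow_le_rpow (by linarith) ?_ hα) hA
    refine h2.trans ?_
    rw [mul_comm]
    exact mul_le_mul_of_nonneg_left (le_max_left _ _) (by linarith)
  · exact hup.trans (mul_le_mul_of_nonneg_left (Real.rpow_le_rpow (by linarith) h1 hα) hB)

lemma pow_bounds_of_comparable {κ N lam A B n : ℝ} {a : ℕ} (hN : 1 ≤ N) (h1 : N ≤ κ)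
    (h2 : κ ≤ lam * N) (hA : 0 ≤ A) (hB : 0 ≤ B) (hlow : A * N ^ a ≤ n) (hup : n ≤ B * N ^ a) :
    A / (max lam 1) ^ a * κ ^ a ≤ n ∧ n ≤ B * κ ^ a := by
  have := rpow_bounds_of_comparable (α := a) (A := A) (B := B) (n := n) hN h1 h2 (by positivity) hA hB
    (by rwa [Real.rpow_natCast]) (by rwa [Real.rpow_natCast])
  simpa only [Real.rpow_natCast] using this

variable {q β n a b M κ : ℕ} {lam : ℝ}

lemma length_bounds_const_order (hq : 2 ≤ q) (hn : (q ^ β) ^ a ≤ n * q ^ b)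
    (hn' : n * q ^ b ≤ M * (q ^ β) ^ a) (h1 : q ^ β ≤ κ) (h2 : (κ : ℝ) ≤ lam * (q : ℝ) ^ β) :
    1 / (q : ℝ) ^ b / (max lam 1) ^ a * (κ : ℝ) ^ a ≤ n ∧
      (n : ℝ) ≤ M / (q : ℝ) ^ b * (κ : ℝ) ^ a := by
  have hq0 : (0 : ℝ) < (q : ℝ) ^ b := by positivity
  refine pow_bounds_of_comparable (N := (q : ℝ) ^ β) ?_ (by exact_mod_cast h1) h2 (by positivity)
    (by positivity) ?_ ?_
  · exact_mod_cast Nat.one_le_pow _ _ (by omega)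
  · rw [div_mul_eq_mul_div, div_le_iff₀ hq0, one_mul]
    exact_mod_cast hn
  · rw [div_mul_eq_mul_div, le_div_iff₀ hq0]
    exact_mod_cast hn'

/-- With `N = q ^ β` one has `q ^ b = N ^ (b / β)`, which lowers the exponent `a` by `b / β`. -/
lemma length_bounds_const_dim (hq : 2 ≤ q) (hβ : 2 ≤ β) (hba : b ≤ a)
    (hn : (q ^ β) ^ a ≤ n * q ^ b) (hn' : n * q ^ b ≤ M * (q ^ β) ^ a) (h1 : q ^ β ≤ κ)
    (h2 : (κ : ℝ) ≤ lam * (q : ℝ) ^ β) :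
    1 / (max lam 1) ^ ((a : ℝ) - b / β) * (κ : ℝ) ^ ((a : ℝ) - b / β) ≤ n ∧
      (n : ℝ) ≤ M * (κ : ℝ) ^ ((a : ℝ) - b / β) := by
  have hq0 : (0 : ℝ) < (q : ℝ) ^ b := by positivity
  have hqp : (0 : ℝ) < q := by positivity
  have hβ0 : (0 : ℝ) < β := by positivity
  have hpow : ((q : ℝ) ^ β) ^ ((a : ℝ) - b / β) = ((q : ℝ) ^ β) ^ a / (q : ℝ) ^ b := by
    rw [Real.rpow_sub (by positivity), Real.rpow_natCast, ← Real.rpow_natCast (q : ℝ) β,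
      ← Real.rpow_mul hqp.le ((β : ℕ) : ℝ) (b / β), mul_div_cancel₀ _ hβ0.ne', Real.rpow_natCast,
      Real.rpow_natCast]
  refine rpow_bounds_of_comparable (N := (q : ℝ) ^ β) ?_ (by exact_mod_cast h1) h2 ?_ zero_le_one
    (by positivity) ?_ ?_
  · exact_mod_cast Nat.one_le_pow _ _ (by omega)
  · rw [sub_nonneg, div_le_iff₀ hβ0]
    exact_mod_cast hba.trans (Nat.le_mul_of_pos_right _ (by omega))
  · rw [hpow, one_mul, div_le_iff₀ hq0]
    exact_mod_cast hn
  · rw [hpow, mul_div_assoc', le_div_iff₀ hq0]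
    exact_mod_cast hn'

/-- The number of lines through a point is between `q ^ (β - 1)` and twice that; the factor `q`
avoids division. -/
lemma replication_bounds (hq : 2 ≤ q) (hβ : β ≠ 0) :
    q ^ β ≤ (q ^ β - 1) / (q - 1) * q ∧ (q ^ β - 1) / (q - 1) * q ≤ 2 * q ^ β := by
  have h1 := div_mul_sub_one q β
  have hN : q ≤ q ^ β := Nat.le_self_pow hβ q
  have ht : 0 < (q ^ β - 1) / (q - 1) := Nat.div_pos (by omega) (by omega)
  obtain ⟨s, rfl⟩ := Nat.exists_eq_add_of_le hq
  rw [show 2 + s - 1 = s + 1 by omega] at *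
  generalize ((2 + s) ^ β - 1) / (s + 1) = t at *
  constructor
  · have : (2 + s) ^ β = t * (s + 1) + 1 := by omega
    nlinarith
  · have : t * (s + 1) ≤ (2 + s) ^ β := by omega
    nlinarith [Nat.zero_le (t * s)]

lemma projective_card_ge (hq : 2 ≤ q) (hβ : β ≠ 0) : q ^ β ≤ (q ^ (β + 1) - 1) / (q - 1) := by
  rw [projective_card_eq hq]
  exact (replication_bounds hq hβ).1.trans (Nat.le_succ _)

lemma affine_length_bounds (hq : 2 ≤ q) (hβ : β ≠ 0) :
    (q ^ β) ^ 2 ≤ (q ^ β - 1) / (q - 1) * q ^ β * q ^ 1 ∧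
      (q ^ β - 1) / (q - 1) * q ^ β * q ^ 1 ≤ 2 * (q ^ β) ^ 2 := by
  obtain ⟨h1, h2⟩ := replication_bounds hq hβ
  constructor <;> nlinarith

lemma projective_length_bounds (hq : 2 ≤ q) (hβ : β ≠ 0) :
    (q ^ β) ^ 2 ≤ (q ^ β - 1) / (q - 1) * ((q ^ (β + 1) - 1) / (q - 1)) * q ^ 1 ∧
      (q ^ β - 1) / (q - 1) * ((q ^ (β + 1) - 1) / (q - 1)) * q ^ 1 ≤ 4 * (q ^ β) ^ 2 := by
  obtain ⟨h1, h2⟩ := replication_bounds hq hβ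
  have h4 := projective_card_le hq β
  have h5 := projective_card_ge hq hβ
  rw [mul_right_comm, pow_one]
  constructor
  · exact (pow_two _).trans_le (Nat.mul_le_mul h1 h5)
  · exact (Nat.mul_le_mul h2 h4).trans_eq (by ring)

lemma spherical_length_bounds (hq : 2 ≤ q) (hβ : β ≠ 0) :
    (q ^ β) ^ 3 ≤ (q ^ β).choose 2 / q.choose 2 * (q ^ β + 1) * q ^ 2 ∧
      (q ^ β).choose 2 / q.choose 2 * (q ^ β + 1) * q ^ 2 ≤ 4 * (q ^ β) ^ 3 := by
  have hN : q ≤ q ^ β := Nat.le_self_pow hβ q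
  have h1 := Nat.div_mul_cancel (choose_two_dvd (q := q) hβ)
  have h2 := choose_two_mul_two q
  have h3 := choose_two_mul_two (q ^ β)
  rw [← h1, mul_assoc, h2] at h3
  generalize (q ^ β).choose 2 / q.choose 2 = t at *
  generalize q ^ β = N at *
  obtain ⟨s, rfl⟩ := Nat.exists_eq_add_of_le hq
  obtain ⟨k, rfl⟩ := Nat.exists_eq_add_of_le hN
  rw [show 2 + s - 1 = s + 1 by omega, show 2 + s + k - 1 = s + k + 1 by omega] at h3
  -- In terms of `q = 2 + s` and `N = q + k`, `h3` reads `t q (q - 1) = N (N - 1)`; the factor `s +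
  -- 1 = q - 1` is cancelled.
  have h4 : (2 + s + k) ^ 2 ≤ t * (2 + s) ^ 2 := by
    refine Nat.le_of_mul_le_mul_right ?_ (Nat.succ_pos s)
    have : t * (2 + s) ^ 2 * (s + 1) = (2 + s + k) * (s + k + 1) * (2 + s) := by rw [← h3]; ring
    rw [this]
    nlinarith [Nat.zero_le ((2 + s + k) * k)]
  have h5 : t * (2 + s) ^ 2 ≤ 2 * (2 + s + k) ^ 2 := by
    have : t * (2 + s) ^ 2 ≤ 2 * (t * ((2 + s) * (s + 1))) := by
      nlinarith [Nat.zero_le (t * (2 + s) * s)]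
    nlinarith
  rw [mul_right_comm]
  constructor
  · rw [pow_succ]
    exact Nat.mul_le_mul h4 (Nat.le_succ _)
  · exact (Nat.mul_le_mul h5 (show _ ≤ 2 * (2 + s + k) by omega)).trans_eq (by ring)

lemma cyclotomic_length_bounds {u : ℕ} {p m : Fin u → ℕ} {n₂ P e : ℕ}
    (hp : ∀ i, (p i).Prime) (hm : ∀ i, 0 < m i) (he : ∀ i, e ∣ p i ^ m i - 1)
    (hn₂ : n₂ = ∏ i, p i ^ m i) (hP : P = ∏ i, (p i ^ m i - 1)) (he0 : 0 < e) :
    0 < n₂ ∧ e ^ u ∣ P ∧ (e * n₂) ^ 2 ≤ P / e ^ u * (e * n₂) * (e ^ (u + 1) * 2 ^ u) ∧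
      P / e ^ u * (e * n₂) ≤ (e * n₂) ^ 2 := by
  have h1 : ∀ i, 1 < p i ^ m i := fun i => Nat.one_lt_pow (hm i).ne' (hp i).one_lt
  have hdvd : e ^ u ∣ P := by
    rw [hP]
    simpa using Finset.prod_dvd_prod_of_dvd (fun _ : Fin u => e) _ fun i (_ : i ∈ Finset.univ) => he i
  have hPn : P ≤ n₂ := by
    rw [hP, hn₂]
    exact Finset.prod_le_prod' fun i _ => Nat.sub_le _ _
  -- Each factor `x = p_i ^ m_i ≥ 2` satisfies `x ≤ 2 (x - 1)`.
  have hnP : n₂ ≤ P * 2 ^ u := by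
    have : ∏ _i : Fin u, 2 = 2 ^ u := by simp
    rw [hP, hn₂, ← this, ← Finset.prod_mul_distrib]
    exact Finset.prod_le_prod' fun i _ => by have := h1 i; omega
  refine ⟨?_, hdvd, ?_, ?_⟩
  · rw [hn₂]
    exact Finset.prod_pos fun i _ => by have := h1 i; omega
  · have h2 := Nat.div_mul_cancel hdvd
    have : P / e ^ u * (e * n₂) * (e ^ (u + 1) * 2 ^ u) =
        (P / e ^ u * e ^ u) * 2 ^ u * (e * (e * n₂)) := by ring
    rw [this, h2]
    calc (e * n₂) ^ 2 = n₂ * (e * (e * n₂)) := by ring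
      _ ≤ _ := Nat.mul_le_mul_right _ hnP
  · rw [pow_two]
    exact Nat.mul_le_mul_right _ ((Nat.div_le_self _ _).trans
      (hPn.trans (Nat.le_mul_of_pos_left _ he0)))

end Lengths

/-! ### Assembly of the theorem -/

theorem mainTheorem7 :
    -- General part: every regular block system outside `S` can be arranged.
    (∀ (K : Type u) [Field K] [Fintype K] [DecidableEq K] (ℓ r δ v t ρ : ℕ),
      1 ≤ δ → 1 ≤ v → v ≤ r →
      ∀ (S X : Finset K) (𝓑 : Finset (Finset K)),
        S.card = r - v → X.card = ρ → 𝓑.card = ℓ + 1 → Disjoint S X →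
        (∀ B ∈ 𝓑, B ⊆ X ∧ B.card = r + δ - 1) → IsRegularSystem t X 𝓑 →
        ∃ D : RearrangedData K ℓ r δ v t ρ,
          D.points = X ∧ D.blocks = 𝓑 ∧ D.parityPoints = S) ∧
    -- General part: parameters, locality and recovery, with `h = r - v`.
    (∀ (K : Type u) [Field K] [Fintype K] [DecidableEq K] (ℓ r δ v t ρ : ℕ),
      1 ≤ δ → 1 ≤ v → v ≤ r →
      ∀ D : RearrangedData K ℓ r δ v t ρ,
        IsLinearCode D.code (t * ρ) (ℓ * r + v) ∧ HasInfoLocality D.code r δ ∧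
        (IsPacking 2 ρ (r + δ - 1) D.points D.blocks →
          (r - v ≤ δ ^ 2 →
            (∀ E : Finset (Fin t × Fin ρ), E.card ≤ (r - v) + δ - 1 →
              Recoverable D.code (E : Set (Fin t × Fin ρ))) ∧
            (∀ y : ℕ, y ≤ 2 →
              RecoversColumnsAnd D.code y (((r - v : ℕ) : ℤ) - 2 * y - 1)) ∧
            (∀ y : ℕ, y.choose 2 ≤ δ →
              RecoversColumnsAnd D.code y (((r - v : ℕ) : ℤ) - 2 - y.choose 2 - y))) ∧
          (∀ y : ℕ, (y : ℤ) < ((δ : ℤ) + 1) * δ / 2 - 1 →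
            RecoversColumnsAnd D.code y
              (min (((δ : ℤ) + 1) * δ / 2 - 2 * y - 1)
                (((r - v : ℕ) : ℤ) + δ - 1 - 2 * y))))) ∧
    -- Affine geometries: `(2, q₁, q₁ ^ β)`-Steiner systems.
    (∀ q₁ β r δ v ℓ : ℕ, IsPrimePow q₁ → 2 ≤ β → 2 ≤ δ → q₁ = r + δ - 1 →
      1 ≤ v → v ≤ r - 1 → ℓ + 1 = q₁ ^ (β - 1) * (q₁ ^ β - 1) / (q₁ - 1) →
      (∃ q : ℕ, q.Prime ∧ q₁ ^ β + (r - v) ≤ q ∧ q ≤ 4 * q₁ ^ β) ∧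
      ∀ (K : Type u) [Field K] [Fintype K] [DecidableEq K],
        (q₁ ^ β + (r - v) ≤ Fintype.card K →
          ∃ D : RearrangedData K ℓ r δ v ((q₁ ^ β - 1) / (q₁ - 1)) (q₁ ^ β),
            IsSteiner 2 q₁ (q₁ ^ β) D.points D.blocks) ∧
        ∀ D : RearrangedData K ℓ r δ v ((q₁ ^ β - 1) / (q₁ - 1)) (q₁ ^ β),
          IsSteiner 2 q₁ (q₁ ^ β) D.points D.blocks → r - v ≤ δ ^ 2 →
          IsLinearCode D.code (q₁ ^ β * (q₁ ^ β - 1) / (q₁ - 1)) (ℓ * r + v) ∧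
          minDist D.code = (r - v) + δ ∧ IsOptimalLRC D.code r δ ∧
          HasGSDItems D.code r δ (r - v)) ∧
    -- Affine geometries: length `Θ(q ^ 2)` for constant `q₁`.
    (∀ (q₁ r δ v : ℕ) (Λ : ℝ), IsPrimePow q₁ → 2 ≤ δ → q₁ = r + δ - 1 → 1 ≤ v → v ≤ r - 1 →
      ∃ c C : ℝ, 0 < c ∧ 0 < C ∧ ∀ β ℓ : ℕ, 2 ≤ β →
        ∀ (K : Type u) [Field K] [Fintype K] [DecidableEq K]
          (D : RearrangedData K ℓ r δ v ((q₁ ^ β - 1) / (q₁ - 1)) (q₁ ^ β)),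
          (Fintype.card K : ℝ) ≤ Λ * (q₁ : ℝ) ^ β →
          c * (Fintype.card K : ℝ) ^ 2 ≤ codeLength D.code ∧
          (codeLength D.code : ℝ) ≤ C * (Fintype.card K : ℝ) ^ 2) ∧
    -- Affine geometries: length `Θ(q ^ (2 - 1 / β))` for constant `β`.
    (∀ (β : ℕ) (Λ : ℝ), 2 ≤ β →
      ∃ c C : ℝ, 0 < c ∧ 0 < C ∧ ∀ q₁ r δ v ℓ : ℕ, IsPrimePow q₁ → 2 ≤ δ → q₁ = r + δ - 1 →
        1 ≤ v → v ≤ r - 1 →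
        ∀ (K : Type u) [Field K] [Fintype K] [DecidableEq K]
          (D : RearrangedData K ℓ r δ v ((q₁ ^ β - 1) / (q₁ - 1)) (q₁ ^ β)),
          (Fintype.card K : ℝ) ≤ Λ * (q₁ : ℝ) ^ β →
          c * (Fintype.card K : ℝ) ^ (2 - 1 / (β : ℝ)) ≤ codeLength D.code ∧
          (codeLength D.code : ℝ) ≤ C * (Fintype.card K : ℝ) ^ (2 - 1 / (β : ℝ))) ∧
    -- Projective geometries: `(2, q₁ + 1, (q₁ ^ (β + 1) - 1) / (q₁ - 1))`-Steiner systems.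
    (∀ q₁ β r δ v ℓ : ℕ, IsPrimePow q₁ → 2 ≤ β → 2 ≤ δ → q₁ + 1 = r + δ - 1 →
      1 ≤ v → v ≤ r - 1 →
      ℓ + 1 = (q₁ ^ (β + 1) - 1) * (q₁ ^ β - 1) / ((q₁ - 1) * (q₁ ^ 2 - 1)) →
      (∃ q : ℕ, q.Prime ∧ (q₁ ^ (β + 1) - 1) / (q₁ - 1) + (r - v) ≤ q ∧ q ≤ 8 * q₁ ^ β) ∧
      ∀ (K : Type u) [Field K] [Fintype K] [DecidableEq K],
        ((q₁ ^ (β + 1) - 1) / (q₁ - 1) + (r - v) ≤ Fintype.card K →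
          ∃ D : RearrangedData K ℓ r δ v
              ((q₁ ^ β - 1) / (q₁ - 1)) ((q₁ ^ (β + 1) - 1) / (q₁ - 1)),
            IsSteiner 2 (q₁ + 1) ((q₁ ^ (β + 1) - 1) / (q₁ - 1)) D.points D.blocks) ∧
        ∀ D : RearrangedData K ℓ r δ v
            ((q₁ ^ β - 1) / (q₁ - 1)) ((q₁ ^ (β + 1) - 1) / (q₁ - 1)),
          IsSteiner 2 (q₁ + 1) ((q₁ ^ (β + 1) - 1) / (q₁ - 1)) D.points D.blocks →
          r - v ≤ δ ^ 2 →
          IsLinearCode D.code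
            ((q₁ ^ (β + 1) - 1) * (q₁ ^ β - 1) / (q₁ - 1) ^ 2) (ℓ * r + v) ∧
          minDist D.code = (r - v) + δ ∧ IsOptimalLRC D.code r δ ∧
          HasGSDItems D.code r δ (r - v)) ∧
    -- Projective geometries: length `Θ(q ^ 2)` for constant `q₁`.
    (∀ (q₁ r δ v : ℕ) (Λ : ℝ), IsPrimePow q₁ → 2 ≤ δ → q₁ + 1 = r + δ - 1 → 1 ≤ v → v ≤ r - 1 →
      ∃ c C : ℝ, 0 < c ∧ 0 < C ∧ ∀ β ℓ : ℕ, 2 ≤ β →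
        ∀ (K : Type u) [Field K] [Fintype K] [DecidableEq K]
          (D : RearrangedData K ℓ r δ v
            ((q₁ ^ β - 1) / (q₁ - 1)) ((q₁ ^ (β + 1) - 1) / (q₁ - 1))),
          (Fintype.card K : ℝ) ≤ Λ * (q₁ : ℝ) ^ β →
          c * (Fintype.card K : ℝ) ^ 2 ≤ codeLength D.code ∧
          (codeLength D.code : ℝ) ≤ C * (Fintype.card K : ℝ) ^ 2) ∧
    -- Projective geometries: length `Θ(q ^ (2 - 1 / β))` for constant `β`.
    (∀ (β : ℕ) (Λ : ℝ), 2 ≤ β →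
      ∃ c C : ℝ, 0 < c ∧ 0 < C ∧ ∀ q₁ r δ v ℓ : ℕ, IsPrimePow q₁ → 2 ≤ δ →
        q₁ + 1 = r + δ - 1 → 1 ≤ v → v ≤ r - 1 →
        ∀ (K : Type u) [Field K] [Fintype K] [DecidableEq K]
          (D : RearrangedData K ℓ r δ v
            ((q₁ ^ β - 1) / (q₁ - 1)) ((q₁ ^ (β + 1) - 1) / (q₁ - 1))),
          (Fintype.card K : ℝ) ≤ Λ * (q₁ : ℝ) ^ β →
          c * (Fintype.card K : ℝ) ^ (2 - 1 / (β : ℝ)) ≤ codeLength D.code ∧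
          (codeLength D.code : ℝ) ≤ C * (Fintype.card K : ℝ) ^ (2 - 1 / (β : ℝ))) ∧
    -- Spherical geometries: `(3, q₁ + 1, q₁ ^ β + 1)`-Steiner systems; here two blocks may share
    -- two points, and the bound on `h` is `h ≤ ⌈δ / 2⌉ δ`.
    (∀ q₁ β r δ v ℓ : ℕ, IsPrimePow q₁ → 2 ≤ β → 2 ≤ δ → q₁ + 1 = r + δ - 1 →
      1 ≤ v → v ≤ r - 1 →
      ℓ + 1 = (q₁ ^ β + 1) * (q₁ ^ β).choose 2 / ((q₁ + 1) * q₁.choose 2) →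
      (∃ q : ℕ, q.Prime ∧ q₁ ^ β + 1 + (r - v) ≤ q ∧ q ≤ 8 * q₁ ^ β) ∧
      ∀ (K : Type u) [Field K] [Fintype K] [DecidableEq K],
        (q₁ ^ β + 1 + (r - v) ≤ Fintype.card K →
          ∃ D : RearrangedData K ℓ r δ v ((q₁ ^ β).choose 2 / q₁.choose 2) (q₁ ^ β + 1),
            IsSteiner 3 (q₁ + 1) (q₁ ^ β + 1) D.points D.blocks) ∧
        ∀ D : RearrangedData K ℓ r δ v ((q₁ ^ β).choose 2 / q₁.choose 2) (q₁ ^ β + 1),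
          IsSteiner 3 (q₁ + 1) (q₁ ^ β + 1) D.points D.blocks →
          r - v ≤ ⌈(δ : ℚ) / 2⌉₊ * δ →
          IsLinearCode D.code
            ((q₁ ^ β + 1) * ((q₁ ^ β).choose 2 / q₁.choose 2)) (ℓ * r + v) ∧
          minDist D.code = (r - v) + δ ∧ IsOptimalLRC D.code r δ ∧
          HasGSDItems D.code r δ (r - v)) ∧
    -- Spherical geometries: length `Θ(q ^ 3)` for constant `q₁`.
    (∀ (q₁ r δ v : ℕ) (Λ : ℝ), IsPrimePow q₁ → 2 ≤ δ → q₁ + 1 = r + δ - 1 → 1 ≤ v → v ≤ r - 1 →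
      ∃ c C : ℝ, 0 < c ∧ 0 < C ∧ ∀ β ℓ : ℕ, 2 ≤ β →
        ∀ (K : Type u) [Field K] [Fintype K] [DecidableEq K]
          (D : RearrangedData K ℓ r δ v ((q₁ ^ β).choose 2 / q₁.choose 2) (q₁ ^ β + 1)),
          (Fintype.card K : ℝ) ≤ Λ * (q₁ : ℝ) ^ β →
          c * (Fintype.card K : ℝ) ^ 3 ≤ codeLength D.code ∧
          (codeLength D.code : ℝ) ≤ C * (Fintype.card K : ℝ) ^ 3) ∧
    -- Spherical geometries: length `Θ(q ^ (3 - 2 / β))` for constant `β`.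
    (∀ (β : ℕ) (Λ : ℝ), 2 ≤ β →
      ∃ c C : ℝ, 0 < c ∧ 0 < C ∧ ∀ q₁ r δ v ℓ : ℕ, IsPrimePow q₁ → 2 ≤ δ →
        q₁ + 1 = r + δ - 1 → 1 ≤ v → v ≤ r - 1 →
        ∀ (K : Type u) [Field K] [Fintype K] [DecidableEq K]
          (D : RearrangedData K ℓ r δ v ((q₁ ^ β).choose 2 / q₁.choose 2) (q₁ ^ β + 1)),
          (Fintype.card K : ℝ) ≤ Λ * (q₁ : ℝ) ^ β →
          c * (Fintype.card K : ℝ) ^ (3 - 2 / (β : ℝ)) ≤ codeLength D.code ∧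
          (codeLength D.code : ℝ) ≤ C * (Fintype.card K : ℝ) ^ (3 - 2 / (β : ℝ))) ∧
    -- Cyclotomic regular packings, with `n₂ = ∏ pᵢ ^ mᵢ`, `e ∣ pᵢ ^ mᵢ - 1` and
    -- `P = ∏ (pᵢ ^ mᵢ - 1)`.
    (∀ (u' : ℕ) (p m : Fin u' → ℕ) (n₂ P e r δ v ℓ : ℕ), 1 ≤ u' →
      (∀ i, (p i).Prime) → Function.Injective p → (∀ i, 0 < m i) →
      (∀ i, e ∣ p i ^ m i - 1) → n₂ = ∏ i, p i ^ m i → P = ∏ i, (p i ^ m i - 1) →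
      2 ≤ δ → e = r + δ - 1 → 1 ≤ v → v ≤ r - 1 → ℓ + 1 = n₂ * P / e ^ u' →
      (∃ q : ℕ, q.Prime ∧ e * n₂ + (r - v) ≤ q ∧ q ≤ 4 * (e * n₂)) ∧
      ∀ (K : Type u) [Field K] [Fintype K] [DecidableEq K],
        (e * n₂ + (r - v) ≤ Fintype.card K →
          ∃ D : RearrangedData K ℓ r δ v (P / e ^ u') (e * n₂),
            IsPacking 2 (e * n₂) e D.points D.blocks) ∧
        ∀ D : RearrangedData K ℓ r δ v (P / e ^ u') (e * n₂),
          IsPacking 2 (e * n₂) e D.points D.blocks → r - v ≤ δ ^ 2 →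
          IsLinearCode D.code (n₂ * P / e ^ (u' - 1)) (ℓ * r + v) ∧
          minDist D.code = (r - v) + δ ∧ IsOptimalLRC D.code r δ ∧
          HasGSDItems D.code r δ (r - v)) ∧
    -- Cyclotomic regular packings: length `Θ(q ^ 2)` for constant `e`, `u'` and `h`.
    (∀ (u' e r δ v : ℕ) (Λ : ℝ), 1 ≤ u' → 2 ≤ δ → e = r + δ - 1 → 1 ≤ v → v ≤ r - 1 →
      ∃ c C : ℝ, 0 < c ∧ 0 < C ∧ ∀ (p m : Fin u' → ℕ) (n₂ P ℓ : ℕ),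
        (∀ i, (p i).Prime) → Function.Injective p → (∀ i, 0 < m i) →
        (∀ i, e ∣ p i ^ m i - 1) → n₂ = ∏ i, p i ^ m i → P = ∏ i, (p i ^ m i - 1) →
        ∀ (K : Type u) [Field K] [Fintype K] [DecidableEq K]
          (D : RearrangedData K ℓ r δ v (P / e ^ u') (e * n₂)),
          (Fintype.card K : ℝ) ≤ Λ * ((e : ℝ) * n₂) →
          c * (Fintype.card K : ℝ) ^ 2 ≤ codeLength D.code ∧
          (codeLength D.code : ℝ) ≤ C * (Fintype.card K : ℝ) ^ 2) := by
  -- `X` lies in the field, so `N ≤ ρ ≤ q`; together with `q ≤ ΛN` this makes `q` and `N`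
  -- comparable.
  have hlen : ∀ {K : Type u} [Field K] [Fintype K] {ℓ r δ v t ρ N n : ℕ}
      (D : RearrangedData K ℓ r δ v t ρ), t * ρ = n → N ≤ ρ →
      codeLength D.code = n ∧ N ≤ Fintype.card K := fun D hn hN =>
    ⟨D.isLinearCode_code.1.trans hn, hN.trans ((Nat.le_add_right _ _).trans D.card_le)⟩
  refine ⟨?_, ?_, ?_, ?_, ?_, ?_, ?_, ?_, ?_, ?_, ?_, ?_, ?_⟩
  · rintro K _ _ _ ℓ r δ v t ρ hδ _ hvr S X 𝓑 hS rfl h𝓑 hSX hB hreg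
    exact exists_rearrangedData hδ hvr S X 𝓑 hS h𝓑 hSX hB hreg
  · intro K _ _ _ ℓ r δ v t ρ hδ hv hvr D
    refine ⟨D.isLinearCode_code, D.hasInfoLocality_code hδ hvr, fun hpack => ⟨fun hh => ?_,
      fun y _ => D.recoversColumnsAnd_of_inter_le (Or.inl rfl) hδ
        (D.inter_card_le_of_isPacking hpack) y⟩⟩
    obtain ⟨hm, hu⟩ := RearrangedData.small_of_le_sq hh
    obtain ⟨h1, h2, h3⟩ := D.recovers_of_inter_le hδ (D.inter_card_le_of_isPacking hpack) hm hu
    exact ⟨h1, h2, fun y _ => h3 y⟩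
  · intro q₁ β r δ v ℓ hq hβ hδ hqr hv hvr hℓ
    have hN : q₁ ≤ q₁ ^ β := Nat.le_self_pow (by omega) q₁
    refine ⟨?_, fun K _ _ _ => ⟨exists_rearrangedData_affine hq hβ hδ hqr (by omega) hℓ,
      fun D hD hh => ⟨?_, ?_⟩⟩⟩
    -- `h ≤ r ≤ q₁ ≤ q₁ ^ β`, so `ρ + h ≤ 2 q₁ ^ β`, and Bertrand's postulate doubles this bound.
    · have := exists_prime_between (m := q₁ ^ β + (r - v)) (M := 2 * q₁ ^ β) (by omega) (by omega)
      rwa [← mul_assoc] at this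
    · have := D.isLinearCode_code
      rwa [mul_comm, ← Nat.mul_div_assoc _ (by simpa using Nat.sub_dvd_pow_sub_pow q₁ 1 β)] at this
    · obtain ⟨hm, hu⟩ := RearrangedData.small_of_le_sq hh
      exact D.optimal_and_gsd (Or.inl rfl) (by omega) hv (by omega)
        (D.inter_card_le_of_isPacking hD.isPacking) hm hu
  · intro q₁ r δ v Λ hq hδ hqr hv hvr
    have hq2 := hq.two_le
    refine ⟨1 / (q₁ : ℝ) ^ 1 / (max Λ 1) ^ 2, (2 : ℕ) / (q₁ : ℝ) ^ 1, by positivity, by positivity,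
      fun β ℓ hβ K _ _ _ D hK => ?_⟩
    obtain ⟨h1, h2⟩ := hlen D rfl le_rfl
    obtain ⟨h3, h4⟩ := affine_length_bounds hq2 (show β ≠ 0 by omega)
    rw [h1]
    exact length_bounds_const_order hq2 h3 h4 h2 hK
  · intro β Λ hβ
    refine ⟨1 / (max Λ 1) ^ (2 - 1 / (β : ℝ)), 2, by positivity, by positivity,
      fun q₁ r δ v ℓ hq hδ hqr hv hvr K _ _ _ D hK => ?_⟩
    have hq2 := hq.two_le
    obtain ⟨h1, h2⟩ := hlen D rfl le_rfl
    obtain ⟨h3, h4⟩ := affine_length_bounds hq2 (show β ≠ 0 by omega)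
    rw [h1]
    simpa only [Nat.cast_ofNat, Nat.cast_one] using
      length_bounds_const_dim hq2 hβ (by norm_num) h3 h4 h2 hK
  · intro q₁ β r δ v ℓ hq hβ hδ hqr hv hvr hℓ
    have hN : q₁ ≤ q₁ ^ β := Nat.le_self_pow (by omega) q₁
    have hρ := projective_card_le hq.two_le β
    refine ⟨?_, fun K _ _ _ => ⟨exists_rearrangedData_projective hq hβ hδ hqr (by omega) hℓ,
      fun D hD hh => ⟨?_, ?_⟩⟩⟩
    · have := exists_prime_between (m := (q₁ ^ (β + 1) - 1) / (q₁ - 1) + (r - v))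
        (M := 4 * q₁ ^ β) (by omega) (by omega)
      rwa [← mul_assoc] at this
    · have := D.isLinearCode_code
      rwa [Nat.div_mul_div_comm (by simpa using Nat.sub_dvd_pow_sub_pow q₁ 1 β)
        (by simpa using Nat.sub_dvd_pow_sub_pow q₁ 1 (β + 1)), mul_comm, ← pow_two] at this
    · obtain ⟨hm, hu⟩ := RearrangedData.small_of_le_sq hh
      exact D.optimal_and_gsd (Or.inl rfl) (by omega) hv (by omega)
        (D.inter_card_le_of_isPacking hD.isPacking) hm hu
  · intro q₁ r δ v Λ hq hδ hqr hv hvr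
    have hq2 := hq.two_le
    refine ⟨1 / (q₁ : ℝ) ^ 1 / (max Λ 1) ^ 2, (4 : ℕ) / (q₁ : ℝ) ^ 1, by positivity, by positivity,
      fun β ℓ hβ K _ _ _ D hK => ?_⟩
    obtain ⟨h1, h2⟩ := hlen D rfl (projective_card_ge hq2 (show β ≠ 0 by omega))
    obtain ⟨h3, h4⟩ := projective_length_bounds hq2 (show β ≠ 0 by omega)
    rw [h1]
    exact length_bounds_const_order hq2 h3 h4 h2 hK
  · intro β Λ hβ
    refine ⟨1 / (max Λ 1) ^ (2 - 1 / (β : ℝ)), 4, by positivity, by positivity,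
      fun q₁ r δ v ℓ hq hδ hqr hv hvr K _ _ _ D hK => ?_⟩
    have hq2 := hq.two_le
    obtain ⟨h1, h2⟩ := hlen D rfl (projective_card_ge hq2 (show β ≠ 0 by omega))
    obtain ⟨h3, h4⟩ := projective_length_bounds hq2 (show β ≠ 0 by omega)
    rw [h1]
    simpa only [Nat.cast_ofNat, Nat.cast_one] using
      length_bounds_const_dim hq2 hβ (by norm_num) h3 h4 h2 hK
  · intro q₁ β r δ v ℓ hq hβ hδ hqr hv hvr hℓ
    have hN : q₁ ≤ q₁ ^ β := Nat.le_self_pow (by omega) q₁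
    refine ⟨?_, fun K _ _ _ => ⟨exists_rearrangedData_spherical hq hβ hδ hqr (by omega) hℓ,
      fun D hD hh => ⟨?_, ?_⟩⟩⟩
    · have := exists_prime_between (m := q₁ ^ β + 1 + (r - v)) (M := 4 * q₁ ^ β) (by omega)
        (by omega)
      rwa [← mul_assoc] at this
    · have := D.isLinearCode_code
      rwa [mul_comm] at this
    · obtain ⟨hm, hu⟩ := RearrangedData.small_of_le_ceil hh
      exact D.optimal_and_gsd (Or.inr rfl) (by omega) hv (by omega)
        (D.inter_card_le_of_isPacking hD.isPacking) hm hu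
  · intro q₁ r δ v Λ hq hδ hqr hv hvr
    have hq2 := hq.two_le
    refine ⟨1 / (q₁ : ℝ) ^ 2 / (max Λ 1) ^ 3, (4 : ℕ) / (q₁ : ℝ) ^ 2, by positivity, by positivity,
      fun β ℓ hβ K _ _ _ D hK => ?_⟩
    obtain ⟨h1, h2⟩ := hlen D rfl (Nat.le_succ _)
    obtain ⟨h3, h4⟩ := spherical_length_bounds hq2 (show β ≠ 0 by omega)
    rw [h1]
    exact length_bounds_const_order hq2 h3 h4 h2 hK
  · intro β Λ hβ
    refine ⟨1 / (max Λ 1) ^ (3 - 2 / (β : ℝ)), 4, by positivity, by positivity,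
      fun q₁ r δ v ℓ hq hδ hqr hv hvr K _ _ _ D hK => ?_⟩
    have hq2 := hq.two_le
    obtain ⟨h1, h2⟩ := hlen D rfl (Nat.le_succ _)
    obtain ⟨h3, h4⟩ := spherical_length_bounds hq2 (show β ≠ 0 by omega)
    rw [h1]
    simpa only [Nat.cast_ofNat] using
      length_bounds_const_dim hq2 hβ (by norm_num) h3 h4 h2 hK
  · intro u' p m n₂ P e r δ v ℓ hu' hp _ hm he hn₂ hP hδ her hv hvr hℓ
    obtain ⟨hn0, hdvd, -, -⟩ := cyclotomic_length_bounds hp hm he hn₂ hP (by omega)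
    have hen : e ≤ e * n₂ := Nat.le_mul_of_pos_right _ hn0
    refine ⟨?_, fun K _ _ _ =>
      ⟨exists_rearrangedData_cyclotomic hp hm he hn₂ hP hδ her hv (by omega) hℓ,
      fun D hD hh => ⟨?_, ?_⟩⟩⟩
    · have := exists_prime_between (m := e * n₂ + (r - v)) (M := 2 * (e * n₂)) (by omega)
        (by omega)
      rwa [← mul_assoc] at this
    · have := D.isLinearCode_code
      obtain ⟨w, rfl⟩ := Nat.exists_eq_add_of_le hu'
      obtain ⟨s, hs⟩ := hdvd
      have he0 : 0 < e := by omega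
      -- Since `e ^ u'` divides `P`, all the divisions are exact.
      have h1 : P / e ^ (1 + w) * (e * n₂) = n₂ * P / e ^ (1 + w - 1) := by
        rw [Nat.add_sub_cancel_left, hs, Nat.mul_div_cancel_left _ (by positivity), eq_comm]
        refine Nat.div_eq_of_eq_mul_left (by positivity) ?_
        ring
      rwa [h1] at this
    · obtain ⟨hm', hu⟩ := RearrangedData.small_of_le_sq hh
      exact D.optimal_and_gsd (Or.inl rfl) (by omega) hv (by omega)
        (D.inter_card_le_of_isPacking hD) hm' hu
  · intro u' e r δ v Λ hu' hδ her hv hvr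
    have he0 : 0 < e := by omega
    refine ⟨1 / ((e : ℝ) ^ (u' + 1) * 2 ^ u') / (max Λ 1) ^ 2, 1, by positivity, by positivity,
      fun p m n₂ P ℓ hp _ hm he hn₂ hP K _ _ _ D hK => ?_⟩
    obtain ⟨hn0, -, h3, h4⟩ := cyclotomic_length_bounds hp hm he hn₂ hP he0
    obtain ⟨h1, h2⟩ := hlen D rfl le_rfl
    rw [h1]
    refine pow_bounds_of_comparable (N := (e : ℝ) * n₂) ?_ (by exact_mod_cast h2) hK (by positivity)
      zero_le_one ?_ ?_
    · exact_mod_cast Nat.mul_pos he0 hn0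
    · rw [div_mul_eq_mul_div, div_le_iff₀ (by positivity), one_mul]
      exact_mod_cast h3
    · rw [one_mul]
      exact_mod_cast h4
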